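/- Conventions: $[x,y]=x^{-1}y^{-1}xy$, $G'$ is the derived subgroup, $Z(G)$ the centre, $\exp$ the exponent, and $\Omega_r(G)=\langle g\in G : g^{p^r}=1\rangle$. For a prime $p$, a $p\mathcal{E}$-group is a finite $p$-group $G$ which is $2$-Engel (that is, $[[x,y],y]=1$ for all $x,y\in G$) and for which there is an integer $r\ge 0$ with $\exp(G/G')=p^r$ and $\Omega_r(G)\le Z(G)$. A group is called $3$-generator if it is generated by three (not necessarily distinct) elements. For integers $1\le t\le r$ and $T=[t_{ij}]\in GL(3,\mathbb{Z}_{p^t})$ let $G(p,r,t,[t_{ij}])$ be the group with presentation $$\begin{aligned}\langle x,y,z \mid\; & x^{p^{r+t}}=y^{p^{r+t}}=z^{p^{r+t}}=[x^{p^t},y]=[x^{p^t},z]=[y^{p^t},x]=[y^{p^t},z]=[z^{p^t},x]=[z^{p^t},y]=1,\\ & [x,y]=x^{p^rt_{11}}y^{p^rt_{12}}z^{p^rt_{13}},\; [x,z]=x^{p^rt_{21}}y^{p^rt_{22}}z^{p^rt_{23}},\; [y,z]=x^{p^rt_{31}}y^{p^rt_{32}}z^{p^rt_{33}}\rangle,\end{aligned}$$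 where each $t_{ij}$ in an exponent is represented by an integer between $0$ and $p^t-1$ (the group does not depend on the choice of representatives). Theorem. Let $p$ be a prime. (1) Let $G$ be a non-abelian $3$-generator $p\mathcal{E}$-group with $\exp(G/G')=p^r$ and $\exp(G')=p^t$, and suppose that $p>2$, or $p=2$ and $\exp(G')\ne 2^r$. Then $1\le t\le r$, $|G|=p^{3(r+t)}$, and $G\cong G(p,r,t,[t_{ij}])$ for some $[t_{ij}]\in GL(3,\mathbb{Z}_{p^t})$. (2) Conversely, let $1\le t\le r$ be integers such that $p>2$, or $p=2$ and $t\ne r$, and let $[t_{ij}]\in GL(3,\mathbb{Z}_{p^t})$. Then every group isomorphic to $G(p,r,t,[t_{ij}])$ is a $p\mathcal{E}$-group. -/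

import Mathlib

/-- The group commutator in the convention `[x, y] = x⁻¹ y⁻¹ x y`. -/
def gcomm {G : Type*} [Group G] (x y : G) : G := x⁻¹ * y⁻¹ * x * y

/-- `Ω_r(G)`: the subgroup generated by all elements `x` with `x ^ (p ^ r) = 1`. -/
def Omega (p r : ℕ) (G : Type*) [Group G] : Subgroup G :=
  Subgroup.closure {x : G | x ^ (p ^ r) = 1}

/-- A `pℰ`-group: a finite `2`-Engel `p`-group `G` for which there is `r ≥ 0` with
`exp(G/G') = p ^ r` and `Ω_r(G) ≤ Z(G)`. -/
structure IsPEGroup (p : ℕ) (G : Type*) [Group G] : Prop where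
  finite : Finite G
  isPGroup : IsPGroup p G
  two_engel : ∀ x y : G, gcomm (gcomm x y) y = 1
  omega_le_center : ∃ r : ℕ, Monoid.exponent (G ⧸ commutator G) = p ^ r ∧
    Omega p r G ≤ Subgroup.center G

/-- The group is generated by three (not necessarily distinct) elements. -/
def IsThreeGenerator (G : Type*) [Group G] : Prop :=
  ∃ x y z : G, Subgroup.closure {x, y, z} = ⊤

/-- The word `x ^ (p ^ r * t₁) * y ^ (p ^ r * t₂) * z ^ (p ^ r * t₃)` in the free group on
`x, y, z`, where `(t₁, t₂, t₃)` is a row with entries in `ℤ / p ^ t`, each entry being represented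
by its least non-negative residue. -/
def rowWord (p r t : ℕ) (v : Fin 3 → ZMod (p ^ t)) : FreeGroup (Fin 3) :=
  FreeGroup.of 0 ^ (p ^ r * (v 0).val) * FreeGroup.of 1 ^ (p ^ r * (v 1).val) *
    FreeGroup.of 2 ^ (p ^ r * (v 2).val)

/-- The relators of `G(p, r, t, T)`; the generators `x, y, z` are the free generators
with indices `0, 1, 2`. A relation `u = v` is encoded as the relator `u * v⁻¹`. -/
def presRelators (p r t : ℕ) (T : Matrix (Fin 3) (Fin 3) (ZMod (p ^ t))) :
    Set (FreeGroup (Fin 3)) :=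
  let x : FreeGroup (Fin 3) := FreeGroup.of 0
  let y : FreeGroup (Fin 3) := FreeGroup.of 1
  let z : FreeGroup (Fin 3) := FreeGroup.of 2
  {x ^ (p ^ (r + t)), y ^ (p ^ (r + t)), z ^ (p ^ (r + t)),
    gcomm (x ^ (p ^ t)) y, gcomm (x ^ (p ^ t)) z,
    gcomm (y ^ (p ^ t)) x, gcomm (y ^ (p ^ t)) z,
    gcomm (z ^ (p ^ t)) x, gcomm (z ^ (p ^ t)) y,
    gcomm x y * (rowWord p r t (T 0))⁻¹,
    gcomm x z * (rowWord p r t (T 1))⁻¹,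
    gcomm y z * (rowWord p r t (T 2))⁻¹}

/-- The group `G(p, r, t, T)` given by generators and relations. -/
abbrev PresG (p r t : ℕ) (T : Matrix (Fin 3) (Fin 3) (ZMod (p ^ t))) : Type :=
  PresentedGroup (presRelators p r t T)

/-! Reduction to class two. In a 2-Engel group the normal closure of an element is abelian, and
conjugation on it gives operators with `(ρ g - 1)² = 0`. Such operators anticommute, which makes
triple commutators alternating, of order dividing 3, and central. With three generators the third
lower central term is therefore generated by `u = [[g₀,g₁],g₂]`. For `c = g₀ ^ p ^ r`, an element of
`G'`, the map `b ↦ [c,b]` is a homomorphism into `⟨u⟩`, so it kills `b = g₁` or some `b = g₁ᵏg₂`.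
Then `[g₀,b] ^ p ^ r = 1`, hence `[g₀,b]` is central by the condition on `Ω_r`, and this forces `u =
1` (`commutator_le_center_of_engel`).

Linear algebra in class two. Let `C, P : ℤ³ → Z(G)` send the basis to the three commutators in
cyclic order and to the `g i ^ p ^ r`. Commutators of ordered products are `C (a ⨯₃ b)`; the range
of `P` lies in that of `C`; and `P a = 0` forces `C (a ⨯₃ b) = 0` for all `b`, because `p ^ r`-th
powering is a homomorphism and elements it kills are central. Modulo `p`, a dimension count with
cross products (`eq_bot_and_ker_eq_bot_of_cross_mem`) shows that both `C` and `P` are independent of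
order `p ^ t` with the same range. The change of basis between them is an invertible matrix modulo
`p ^ t`, and its entries are the `t_ij`.

The presented group. Its elements are ordered products of powers of the generators. The set
`(ℤ/p^(r+t))³` with `a * b = a + b + p^r B(a,b)` satisfies the relations without further collapse,
so it is isomorphic to the presented group. This gives the order, and the converse is checked in the
model. -/

/-! ### Operators with square-zero displacement. -/

section EngelRing

variable {G R : Type*} [Group G] [Ring R]

theorem map_inv_of_sq_zero (ρ : G →* R) (h : ∀ g, (ρ g - 1) * (ρ g - 1) = 0) (g : G) :
    ρ g⁻¹ = 1 - (ρ g - 1) := by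
  have h1 : ρ g * ρ g⁻¹ = 1 := by rw [← map_mul, mul_inv_cancel, map_one]
  have h2 : (1 - (ρ g - 1)) * ρ g = 1 := by
    have : (1 - (ρ g - 1)) * ρ g = 1 - (ρ g - 1) * (ρ g - 1) := by noncomm_ring
    rw [this, h, sub_zero]
  calc ρ g⁻¹ = (1 - (ρ g - 1)) * ρ g * ρ g⁻¹ := by rw [h2, one_mul]
    _ = _ := by rw [mul_assoc, h1, mul_one]

/-- With `Y = ρ y - 1` and `Z = ρ z - 1`, multiplying `(Y + Z + YZ)² = 0` by `Y` on the left leaves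
`YZY(Z + 1) = 0`, and `Z + 1 = ρ z` is invertible. -/
theorem mul_mul_eq_zero_of_sq_zero (ρ : G →* R) (h : ∀ g, (ρ g - 1) * (ρ g - 1) = 0) (y z : G) :
    (ρ y - 1) * (ρ z - 1) * (ρ y - 1) = 0 := by
  have h1 : ρ z * ρ z⁻¹ = 1 := by rw [← map_mul, mul_inv_cancel, map_one]
  have hy := h y
  have hz := h z
  have hyz := h (y * z)
  rw [map_mul] at hyz
  have e1 : ρ y * ρ z - 1
      = (ρ y - 1) + (ρ z - 1) + (ρ y - 1) * (ρ z - 1) := by noncomm_ring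
  rw [e1] at hyz
  have e2 : ρ z = (ρ z - 1) + 1 := by noncomm_ring
  generalize ρ y - 1 = Y at *
  generalize ρ z - 1 = Z at *
  have e3 : Y * Z * Y * ρ z = 0 := by
    rw [e2]
    have : Y * Z * Y * (Z + 1) = Y * ((Y + Z + Y * Z) * (Y + Z + Y * Z))
        - Y * Y * (Y + Z + Y * Z) - Y * (Z * Z)
        - Y * Y * (Z * Y + Z * Z + Z * Y * Z) := by
      noncomm_ring
    rw [this, hyz, hy, hz]
    simp
  calc Y * Z * Y = Y * Z * Y * (ρ z * ρ z⁻¹) := by rw [h1, mul_one]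
    _ = Y * Z * Y * ρ z * ρ z⁻¹ := by rw [mul_assoc (Y * Z * Y)]
    _ = 0 := by rw [e3, zero_mul]

/-- In the expansion of `(Y + Z + YZ)² = 0` every term except `YZ + ZY` contains a vanishing factor.
-/
theorem mul_anticomm_of_sq_zero (ρ : G →* R) (h : ∀ g, (ρ g - 1) * (ρ g - 1) = 0) (y z : G) :
    (ρ z - 1) * (ρ y - 1) = -((ρ y - 1) * (ρ z - 1)) := by
  have hy := h y
  have hz := h z
  have hyz := h (y * z)
  have h1 := mul_mul_eq_zero_of_sq_zero ρ h y z
  have h2 := mul_mul_eq_zero_of_sq_zero ρ h z y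
  rw [map_mul] at hyz
  have e1 : ρ y * ρ z - 1
      = (ρ y - 1) + (ρ z - 1) + (ρ y - 1) * (ρ z - 1) := by noncomm_ring
  rw [e1] at hyz
  generalize ρ y - 1 = Y at *
  generalize ρ z - 1 = Z at *
  have : Z * Y + Y * Z = (Y + Z + Y * Z) * (Y + Z + Y * Z) - Y * Y - Z * Z
      - Y * Y * Z - Z * Y * Z - Y * Z * Y - Y * (Z * Z) - Y * Z * Y * Z := by noncomm_ring
  rw [hyz, hy, hz, h1, h2] at this
  rw [eq_neg_iff_add_eq_zero, this]
  simp

theorem map_gcomm_of_sq_zero (ρ : G →* R) (h : ∀ g, (ρ g - 1) * (ρ g - 1) = 0) (y z : G) :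
    ρ (gcomm y z) - 1 = (ρ y - 1) * (ρ z - 1) + (ρ y - 1) * (ρ z - 1) := by
  have hy := h y
  have hz := h z
  have h1 := mul_mul_eq_zero_of_sq_zero ρ h y z
  have h2 := mul_mul_eq_zero_of_sq_zero ρ h z y
  have h3 := mul_anticomm_of_sq_zero ρ h y z
  have ey : ρ y = (ρ y - 1) + 1 := by noncomm_ring
  have ez : ρ z = (ρ z - 1) + 1 := by noncomm_ring
  rw [gcomm, map_mul, map_mul, map_mul, map_inv_of_sq_zero ρ h, map_inv_of_sq_zero ρ h]
  generalize ρ y - 1 = Y at *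
  generalize ρ z - 1 = Z at *
  rw [ey, ez]
  have : (1 - Y) * (1 - Z) * (Y + 1) * (Z + 1) - 1 = Y * Z - Z * Y - Y * Y - Z * Z - Y * Y * Z
      + Y * (Z * Z) + Y * Z * Y + Y * Z * Y * Z - Z * Y * Z := by noncomm_ring
  rw [this, hy, hz, h1, h2, h3]
  noncomm_ring

end EngelRing

/-! ### Commutator calculus. -/

section Gcomm

open scoped commutatorElement

variable {G : Type*} [Group G]

theorem gcomm_inv (x y : G) : (gcomm x y)⁻¹ = gcomm y x := by
  simp only [gcomm]; group

theorem gcomm_eq_one_iff {x y : G} : gcomm x y = 1 ↔ Commute x y := by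
  have : gcomm x y = (y * x)⁻¹ * (x * y) := by simp only [gcomm]; group
  rw [this, inv_mul_eq_one]
  exact eq_comm

theorem map_gcomm {H F : Type*} [Group H] [FunLike F G H] [MonoidHomClass F G H] (f : F) (x y : G) :
    f (gcomm x y) = gcomm (f x) (f y) := by
  simp [gcomm]

theorem gcomm_mul_left' (x y z : G) : gcomm (x * y) z = y⁻¹ * gcomm x z * y * gcomm y z := by
  simp only [gcomm]; group

theorem gcomm_mul_right' (x y z : G) : gcomm x (y * z) = gcomm x z * (z⁻¹ * gcomm x y * z) := by
  simp only [gcomm]; group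

theorem gcomm_mem_commutator (x y : G) : gcomm x y ∈ commutator G := by
  have h : gcomm x y = ⁅x⁻¹, y⁻¹⁆ := by simp [gcomm, commutatorElement_def]
  rw [h]
  exact Subgroup.commutator_mem_commutator (Subgroup.mem_top _) (Subgroup.mem_top _)

/-- Powers in the first argument when the commutator commutes with that argument. -/
theorem gcomm_pow_left_of_commute {x y : G} (h : Commute (gcomm x y) x) (n : ℕ) :
    gcomm (x ^ n) y = gcomm x y ^ n := by
  induction n with
  | zero => simp [gcomm]
  | succ n ih =>
    rw [pow_succ, gcomm_mul_left', ih, pow_succ]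
    rw [mul_assoc x⁻¹, ((h.pow_left n).eq), inv_mul_cancel_left]

theorem gcomm_inv_left_of_commute {x y : G} (h : Commute (gcomm x y) x) :
    gcomm x⁻¹ y = (gcomm x y)⁻¹ := by
  have h1 := gcomm_mul_left' x x⁻¹ y
  rw [mul_inv_cancel, inv_inv, h.symm.eq, mul_assoc (gcomm x y), mul_inv_cancel, mul_one] at h1
  have h2 : gcomm 1 y = 1 := by simp [gcomm]
  rw [h2] at h1
  exact (inv_eq_of_mul_eq_one_right h1.symm).symm

end Gcomm

/-! ### Levi's identities for 2-Engel groups. -/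

section Engel

universe u

variable {G : Type u} [Group G]

theorem engel_commute_right (hE : ∀ x y : G, gcomm (gcomm x y) y = 1)
    (x y : G) : Commute (gcomm x y) y := gcomm_eq_one_iff.1 (hE x y)

theorem engel_commute_left (hE : ∀ x y : G, gcomm (gcomm x y) y = 1)
    (x y : G) : Commute (gcomm x y) x := by
  rw [← gcomm_inv]
  exact (engel_commute_right hE y x).inv_left

theorem engel_commute_conj (hE : ∀ x y : G, gcomm (gcomm x y) y = 1)
    (a g : G) : Commute a (g * a * g⁻¹) := by
  have h := engel_commute_left hE a g⁻¹
  have e : g * a * g⁻¹ = a * gcomm a g⁻¹ := by simp only [gcomm]; group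
  rw [e]
  exact (Commute.refl a).mul_right h.symm

theorem engel_commute_conj_conj (hE : ∀ x y : G, gcomm (gcomm x y) y = 1)
    (a g h : G) : Commute (g * a * g⁻¹) (h * a * h⁻¹) := by
  have := (engel_commute_conj hE a (g⁻¹ * h)).map (MulAut.conj g)
  simpa [mul_assoc] using this

theorem engel_normalClosure_comm (hE : ∀ x y : G, gcomm (gcomm x y) y = 1)
    (a : G) :
    ∀ x ∈ Subgroup.normalClosure {a}, ∀ y ∈ Subgroup.normalClosure {a}, x * y = y * x := by
  have : IsMulCommutative (Subgroup.normalClosure {a}) := by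
    refine Subgroup.isMulCommutative_closure ?_
    intro x hx y hy
    rw [Group.mem_conjugatesOfSet_iff] at hx hy
    obtain ⟨_, rfl, hx⟩ := hx
    obtain ⟨_, rfl, hy⟩ := hy
    obtain ⟨g, rfl⟩ := isConj_iff.1 hx
    obtain ⟨k, rfl⟩ := isConj_iff.1 hy
    exact engel_commute_conj_conj hE _ g k
  intro x hx y hy
  exact congrArg Subtype.val (this.is_comm.comm ⟨x, hx⟩ ⟨y, hy⟩)

theorem exists_conj_rep (A : Subgroup G) [A.Normal] (hA : ∀ x ∈ A, ∀ y ∈ A, x * y = y * x) :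
    ∃ (M : Type u) (_ : AddCommGroup M) (ι : M → G) (ρ : G →* AddMonoid.End M),
      Function.Injective ι ∧ (∀ m n, ι (m + n) = ι m * ι n) ∧ (∀ x ∈ A, ∃ m, ι m = x) ∧
      ∀ g m, ι (ρ g m) = g * ι m * g⁻¹ := by
  let _ : CommGroup A := { (inferInstance : Group A) with
    mul_comm := fun x y => Subtype.ext (hA x x.2 y y.2) }
  refine ⟨Additive A, inferInstance, fun m => (m.toMul : G),
    { toFun := fun g => MonoidHom.toAdditive (MulAut.conjNormal g : A ≃* A).toMonoidHom
      map_one' := by ext; simp; rfl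
      map_mul' := by intro g h; ext; simp; rfl }, ?_, ?_, ?_, ?_⟩
  · intro m n h
    exact Subtype.ext h
  · intro m n; rfl
  · intro x hx; exact ⟨Additive.ofMul ⟨x, hx⟩, rfl⟩
  · intro g m
    exact MulAut.conjNormal_apply (H := A) g m.toMul

theorem addMonoidEnd_mul_apply {M : Type*} [AddCommGroup M] (f g : AddMonoid.End M) (m : M) :
    (f * g) m = f (g m) := rfl

theorem addMonoidEnd_add_apply {M : Type*} [AddCommGroup M] (f g : AddMonoid.End M) (m : M) :
    (f + g) m = f m + g m := rfl

/-- This turns commutation with `y` into the operator `ρ y⁻¹ - 1` on the abelian normal closure of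
`a`, so that the ring identities above become commutator identities. -/
theorem engel_exists_rep (hE : ∀ x y : G, gcomm (gcomm x y) y = 1) (a : G) :
    ∃ (M : Type u) (_ : AddCommGroup M) (ι : M → G) (ρ : G →* AddMonoid.End M),
      (∀ m n, ι (m + n) = ι m * ι n) ∧ (∃ m, ι m = a) ∧
      (∀ m y, ι ((ρ y⁻¹ - 1) m) = gcomm (ι m) y) ∧ ∀ g, (ρ g - 1) * (ρ g - 1) = 0 := by
  obtain ⟨M, i, ι, ρ, hinj, hadd, hA, hρ⟩ :=
    exists_conj_rep (Subgroup.normalClosure {a}) (engel_normalClosure_comm hE a)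
  have h0 : ι 0 = 1 := by
    have := hadd 0 0
    rw [add_zero] at this
    exact left_eq_mul.1 this
  have hneg : ∀ m, ι (-m) = (ι m)⁻¹ := fun m => by
    rw [eq_inv_iff_mul_eq_one, ← hadd, neg_add_cancel, h0]
  have hD : ∀ m y, ι ((ρ y⁻¹ - 1) m) = gcomm (ι m) y := by
    intro m y
    have e : (ρ y⁻¹ - 1) m = -m + ρ y⁻¹ m := by
      have e' : (ρ y⁻¹ - 1) m = ρ y⁻¹ m - m := rfl
      rw [e', sub_eq_neg_add]
    rw [e, hadd, hneg, hρ, gcomm]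
    group
  refine ⟨M, i, ι, ρ, hadd, hA a (Subgroup.subset_normalClosure rfl), hD, fun g => ?_⟩
  ext m
  apply hinj
  rw [← inv_inv g, addMonoidEnd_mul_apply, hD, hD, hE]
  exact h0.symm

theorem engel_swap_right (hE : ∀ x y : G, gcomm (gcomm x y) y = 1) (a y z : G) :
    gcomm (gcomm a y) z = (gcomm (gcomm a z) y)⁻¹ := by
  obtain ⟨M, i, ι, ρ, hadd, ⟨m, rfl⟩, hD, hsq⟩ := engel_exists_rep hE a
  rw [eq_inv_iff_mul_eq_one, ← hD, ← hD, ← hD, ← hD, ← hadd, ← addMonoidEnd_mul_apply,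
    ← addMonoidEnd_mul_apply, mul_anticomm_of_sq_zero ρ hsq, ← addMonoidEnd_add_apply,
    neg_add_cancel]
  have := hadd 0 0
  rw [add_zero] at this
  exact left_eq_mul.1 this

theorem engel_gcomm_gcomm (hE : ∀ x y : G, gcomm (gcomm x y) y = 1) (a x y : G) :
    gcomm a (gcomm x y) = gcomm (gcomm a x) y ^ 2 := by
  obtain ⟨M, i, ι, ρ, hadd, ⟨m, rfl⟩, hD, hsq⟩ := engel_exists_rep hE a
  rw [← hD, gcomm_inv, map_gcomm_of_sq_zero ρ hsq, pow_two, ← hD, ← hD, ← hadd,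
    map_inv_of_sq_zero ρ hsq, map_inv_of_sq_zero ρ hsq, ← addMonoidEnd_mul_apply,
    ← addMonoidEnd_add_apply]
  congr 2
  noncomm_ring

theorem engel_gcomm_inv_left (hE : ∀ x y : G, gcomm (gcomm x y) y = 1) (x y : G) :
    gcomm x⁻¹ y = (gcomm x y)⁻¹ :=
  gcomm_inv_left_of_commute (engel_commute_left hE x y)

theorem engel_swap_left (hE : ∀ x y : G, gcomm (gcomm x y) y = 1) (x y z : G) :
    gcomm (gcomm x y) z = (gcomm (gcomm y x) z)⁻¹ := by
  rw [← engel_gcomm_inv_left hE, gcomm_inv]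

/-- Triple commutators in a `2`-Engel group have order dividing `3`. -/
theorem engel_gcomm_pow_three (hE : ∀ x y : G, gcomm (gcomm x y) y = 1) (x y z : G) :
    gcomm (gcomm x y) z ^ 3 = 1 := by
  have h1 := engel_gcomm_gcomm hE x y z
  -- A cyclic shift of the entries is an even permutation. Hence the square of the triple commutator
  -- is also its inverse.
  have h2 : (gcomm x (gcomm y z))⁻¹ = gcomm (gcomm x y) z := by
    rw [gcomm_inv, engel_swap_right hE, engel_swap_left hE y x, inv_inv]
  rw [pow_succ, ← h1, ← h2, mul_inv_cancel]

/-- A `2`-Engel group has nilpotency class at most `3`. -/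
theorem engel_gcomm_four (hE : ∀ x y : G, gcomm (gcomm x y) y = 1) (x y z w : G) :
    gcomm (gcomm (gcomm x y) z) w = 1 := by
  have s1 : ∀ x y z w : G, gcomm (gcomm (gcomm x y) z) w = (gcomm (gcomm (gcomm y x) z) w)⁻¹ := by
    intro x y z w
    rw [engel_swap_left hE x y, engel_gcomm_inv_left hE]
  have s2 : ∀ x y z w : G, gcomm (gcomm (gcomm x y) z) w = (gcomm (gcomm (gcomm x z) y) w)⁻¹ := by
    intro x y z w
    rw [engel_swap_right hE x y z, engel_gcomm_inv_left hE]
  have s3 : ∀ x y z w : G, gcomm (gcomm (gcomm x y) z) w = (gcomm (gcomm (gcomm x y) w) z)⁻¹ :=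
    fun x y z w => engel_swap_right hE _ _ _
  -- Exchanging the pairs `(x, y)` and `(z, w)` is an even permutation, so it fixes the fourfold
  -- commutator `f`. Then `[[x,y],[z,w]]` and its inverse both equal `f²`, giving `f⁴ = 1` besides
  -- `f³ = 1`.
  have e : gcomm (gcomm (gcomm z w) x) y = gcomm (gcomm (gcomm x y) z) w := by
    rw [s2 x y, s1 x z, s3 z x, s2 z x, inv_inv, inv_inv]
  have h1 := engel_gcomm_gcomm hE (gcomm x y) z w
  have h2 := engel_gcomm_gcomm hE (gcomm z w) x y
  rw [e, ← gcomm_inv, h1] at h2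
  have h3 := engel_gcomm_pow_three hE (gcomm x y) z w
  generalize gcomm (gcomm (gcomm x y) z) w = f at *
  have h4 : f ^ 4 = 1 := by
    calc f ^ 4 = f ^ 2 * f ^ 2 := by rw [← pow_add]
      _ = f ^ 2 * (f ^ 2)⁻¹ := by rw [h2]
      _ = 1 := mul_inv_cancel _
  rwa [pow_succ, h3, one_mul] at h4

end Engel

theorem ite_eq_single {ι R : Type*} [DecidableEq ι] [Zero R] [One R] (x : ι) :
    (fun j => if x = j then (1 : R) else 0) = Pi.single x 1 := by
  ext j
  simp [Pi.single_apply, eq_comm]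

/-! ### A dimension count with cross products over a field. -/

section CrossProduct

open scoped Matrix
open Module

variable {F : Type*} [Field F]

theorem mem_span_of_cross_eq_zero {n a : Fin 3 → F} (hn : n ≠ 0) (h : n ⨯₃ a = 0) :
    a ∈ F ∙ n := by
  obtain ⟨i, hi⟩ := Function.ne_iff.1 hn
  rw [Pi.zero_apply] at hi
  have h0 := congrFun h 0
  have h1 := congrFun h 1
  have h2 := congrFun h 2
  simp only [cross_apply, Matrix.cons_val, Pi.zero_apply] at h0 h1 h2
  rw [Submodule.mem_span_singleton]
  refine ⟨a i / n i, ?_⟩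
  ext j
  rw [Pi.smul_apply, smul_eq_mul, div_mul_eq_mul_div, div_eq_iff hi]
  fin_cases i <;> fin_cases j <;> simp only [Fin.zero_eta, Fin.mk_one, Fin.reduceFinMk] <;> grind

/-- If `N` is a proper subspace of `F³` and `a × F³ ≤ N` whenever `L a ∈ N`, then `N` is trivial
and `L` is injective. -/
theorem eq_bot_and_ker_eq_bot_of_cross_mem (N : Submodule F (Fin 3 → F)) (hN : N ≠ ⊤)
    (L : (Fin 3 → F) →ₗ[F] (Fin 3 → F)) (h : ∀ a, L a ∈ N → ∀ b, a ⨯₃ b ∈ N) :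
    N = ⊥ ∧ LinearMap.ker L = ⊥ := by
  obtain ⟨f, hf0, hf⟩ := N.exists_le_ker_of_lt_top (lt_top_iff_ne_top.2 hN)
  set n : Fin 3 → F := fun i => f (Pi.single i 1) with hn
  have hfn : ∀ v, f v = v ⬝ᵥ n := fun v => by
    rw [LinearMap.pi_apply_eq_sum_univ f v]
    simp only [dotProduct, smul_eq_mul, hn, ite_eq_single]
  have hn0 : n ≠ 0 := fun h0 => hf0 (by ext v; simp [h0, hfn])
  set K := N.comap L with hK
  -- `K` is the kernel of a map into the quotient by `N`, so its codimension is at most that of `N`.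
  have hdim : finrank F N ≤ finrank F K := by
    have e : K = LinearMap.ker (N.mkQ ∘ₗ L) := by
      rw [LinearMap.ker_comp, Submodule.ker_mkQ]
    have h1 := (N.mkQ ∘ₗ L).finrank_range_add_finrank_ker
    have h2 := N.finrank_quotient_add_finrank
    have h3 := (LinearMap.range (N.mkQ ∘ₗ L)).finrank_le
    rw [← e] at h1
    omega
  have hKn : ∀ a ∈ K, n ⨯₃ a = 0 := by
    intro a ha
    rw [← dotProduct_eq_zero_iff]
    intro b
    rw [dotProduct_comm, triple_product_permutation, dotProduct_comm, ← hfn]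
    exact hf (h a ha b)
  have hKle : K ≤ F ∙ n := fun a ha => mem_span_of_cross_eq_zero hn0 (hKn a ha)
  have hK1 : finrank F K ≤ 1 :=
    (Submodule.finrank_mono hKle).trans (finrank_span_singleton hn0).le
  have hKbot : K = ⊥ := by
    by_contra hne
    obtain ⟨a, ha, ha0⟩ := K.ne_bot_iff.1 hne
    -- For nonzero `a` in `K` the image of `a ⨯₃ ·` is a plane inside `N`, against `finrank N ≤
    -- finrank K ≤ 1`.
    have h1 := (crossProduct a).finrank_range_add_finrank_ker
    have h2 : LinearMap.range (crossProduct a) ≤ N := by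
      rintro _ ⟨b, rfl⟩
      exact h a ha b
    have h3 : LinearMap.ker (crossProduct a) ≤ F ∙ a := fun b hb =>
      mem_span_of_cross_eq_zero ha0 hb
    have h4 := Submodule.finrank_mono h2
    have h5 := (Submodule.finrank_mono h3).trans (finrank_span_singleton ha0).le
    rw [finrank_fin_fun] at h1
    omega
  constructor
  · rw [← Submodule.finrank_eq_zero (R := F)]
    rw [hKbot, finrank_bot] at hdim
    omega
  · rw [eq_bot_iff, ← hKbot]
    intro a ha
    rw [hK, Submodule.mem_comap, LinearMap.mem_ker.1 ha]
    exact N.zero_mem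

end CrossProduct

/-! ### Lifting the dimension count from `p` to `p ^ t`. -/

section IntegralForms

open scoped Matrix

variable {A : Type*} [AddCommGroup A]

/-- Reduction mod `p` of an integral vector. -/
def redVec (p : ℕ) : (Fin 3 → ℤ) →+ (Fin 3 → ZMod p) :=
  (Int.castAddHom (ZMod p)).compLeft (Fin 3)

theorem redVec_apply (p : ℕ) (n : Fin 3 → ℤ) (i : Fin 3) : redVec p n i = (n i : ZMod p) := rfl

theorem redVec_surjective (p : ℕ) : Function.Surjective (redVec p) := fun v =>
  ⟨fun i => (ZMod.intCast_surjective (v i)).choose,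
    funext fun i => (ZMod.intCast_surjective (v i)).choose_spec⟩

theorem redVec_eq_zero_iff (p : ℕ) (n : Fin 3 → ℤ) : redVec p n = 0 ↔ ∀ i, (p : ℤ) ∣ n i := by
  rw [funext_iff]
  exact forall_congr' fun i => ZMod.intCast_zmod_eq_zero_iff_dvd _ _

theorem redVec_cross (p : ℕ) (a b : Fin 3 → ℤ) : redVec p (a ⨯₃ b) = redVec p a ⨯₃ redVec p b := by
  ext i
  fin_cases i <;> simp [cross_apply, redVec_apply]

theorem exists_smul_of_forall_dvd {q : ℤ} {n : Fin 3 → ℤ} (h : ∀ i, q ∣ n i) :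
    ∃ m : Fin 3 → ℤ, n = q • m := by
  choose m hm using h
  exact ⟨m, funext hm⟩

/-- If relations of `p ^ (t - 1) • C` are divisible by `p`, then relations of `C` are divisible
by `p ^ t`. -/
theorem pow_dvd_of_apply_eq_zero {p t : ℕ} (C : (Fin 3 → ℤ) →ₗ[ℤ] A)
    (h : ∀ n, (p : ℤ) ^ (t - 1) • C n = 0 → ∀ i, (p : ℤ) ∣ n i) (n : Fin 3 → ℤ) (hn : C n = 0) :
    ∀ i, (p : ℤ) ^ t ∣ n i := by
  have key : ∀ k ≤ t, ∀ i, (p : ℤ) ^ k ∣ n i := by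
    intro k
    induction k with
    | zero => intro _ i; simp
    | succ k ih =>
      intro hk
      obtain ⟨m, rfl⟩ := exists_smul_of_forall_dvd (ih (by omega))
      have h1 : (p : ℤ) ^ (t - 1) • C m = 0 := by
        have : t - 1 = (t - 1 - k) + k := by omega
        rw [this, pow_add, mul_smul, ← map_smul, hn, smul_zero]
      intro i
      rw [pow_succ]
      exact mul_dvd_mul_left _ (h m h1 i)
  exact key t le_rfl

theorem exists_matrix_of_range_le (C P : (Fin 3 → ℤ) →ₗ[ℤ] A)
    (hPC : LinearMap.range P ≤ LinearMap.range C) :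
    ∃ M : Matrix (Fin 3) (Fin 3) ℤ, ∀ a, P a = C (M *ᵥ a) := by
  have h : ∀ j, ∃ m, C m = P (Pi.single j 1) := fun j => hPC ⟨_, rfl⟩
  choose m hm using h
  refine ⟨Matrix.of fun i j => m j i, fun a => ?_⟩
  have e : (Matrix.of fun i j => m j i) *ᵥ a = ∑ j, a j • m j := by
    ext i
    simp [Matrix.mulVec, dotProduct, Finset.sum_apply, mul_comm]
  rw [LinearMap.pi_apply_eq_sum_univ P a, e, map_sum]
  exact Finset.sum_congr rfl fun j _ => by rw [map_smul, hm, ite_eq_single]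

/-- Write `P = C ∘ M`. Modulo `p`, the vectors killed by `p ^ (t - 1) • C` form a proper subspace
`N`. If `M a` falls in it, then `P (p ^ (t - 1) • a) = 0`, so `a ⨯₃ b` falls in it too. The
dimension count gives `N = 0` and `M` invertible modulo `p`. -/
theorem independent_of_cross_relations {p t : ℕ} [Fact p.Prime] (ht : 1 ≤ t)
    (C P : (Fin 3 → ℤ) →ₗ[ℤ] A) (hPC : LinearMap.range P ≤ LinearMap.range C)
    (hC : ∀ n, (p : ℤ) ^ t • C n = 0) (hC' : ∃ n, (p : ℤ) ^ (t - 1) • C n ≠ 0)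
    (hcross : ∀ a, P a = 0 → ∀ b, C (a ⨯₃ b) = 0) :
    (∀ n, C n = 0 → ∀ i, (p : ℤ) ^ t ∣ n i) ∧ (∀ a, P a = 0 → ∀ i, (p : ℤ) ^ t ∣ a i) ∧
      LinearMap.range C ≤ LinearMap.range P := by
  obtain ⟨M, hM⟩ := exists_matrix_of_range_le C P hPC
  have hpt : (p : ℤ) ^ (t - 1) * p = (p : ℤ) ^ t := by rw [← pow_succ, Nat.sub_add_cancel ht]
  have hred : ∀ m n, redVec p m = redVec p n →
      (p : ℤ) ^ (t - 1) • C m = (p : ℤ) ^ (t - 1) • C n := by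
    intro m n h
    rw [← sub_eq_zero, ← map_sub, redVec_eq_zero_iff] at h
    obtain ⟨k, hk⟩ := exists_smul_of_forall_dvd h
    rw [← sub_eq_zero, ← smul_sub, ← map_sub, hk, map_smul, smul_smul, hpt, hC]
  let N : Submodule (ZMod p) (Fin 3 → ZMod p) := AddSubgroup.toZModSubmodule p
    { carrier := {v | ∀ n, redVec p n = v → (p : ℤ) ^ (t - 1) • C n = 0}
      zero_mem' := fun n hn => by rw [hred n 0 (by rw [hn, map_zero]), map_zero, smul_zero]
      add_mem' := by
        intro v w hv hw n hn
        obtain ⟨a, rfl⟩ := redVec_surjective p v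
        obtain ⟨b, rfl⟩ := redVec_surjective p w
        rw [hred n (a + b) (by rw [hn, map_add]), map_add, smul_add, hv a rfl, hw b rfl, add_zero]
      neg_mem' := by
        intro v hv n hn
        rw [← neg_eq_zero, ← smul_neg, ← map_neg]
        exact hv _ (by rw [map_neg, hn, neg_neg]) }
  have hN : ∀ n, redVec p n ∈ N ↔ (p : ℤ) ^ (t - 1) • C n = 0 := fun n =>
    ⟨fun h => h n rfl, fun h m hm => by rw [hred m n hm, h]⟩
  have hNtop : N ≠ ⊤ := by
    obtain ⟨n, hn⟩ := hC'
    intro h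
    exact hn ((hN n).1 (h ▸ Submodule.mem_top))
  let L : (Fin 3 → ZMod p) →ₗ[ZMod p] (Fin 3 → ZMod p) :=
    Matrix.toLin' (M.map (Int.castRingHom (ZMod p)))
  have hL : ∀ a, L (redVec p a) = redVec p (M *ᵥ a) := by
    intro a
    ext i
    rw [Matrix.toLin'_apply]
    exact (RingHom.map_mulVec (Int.castRingHom (ZMod p)) M a i).symm
  obtain ⟨hNbot, hLbot⟩ := eq_bot_and_ker_eq_bot_of_cross_mem N hNtop L (by
    intro a' ha b'
    obtain ⟨a, rfl⟩ := redVec_surjective p a'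
    obtain ⟨b, rfl⟩ := redVec_surjective p b'
    rw [hL, hN, ← hM, ← map_smul] at ha
    rw [← redVec_cross, hN, ← map_smul, ← LinearMap.map_smul₂]
    exact hcross _ ha b)
  have hCp : ∀ n, (p : ℤ) ^ (t - 1) • C n = 0 → redVec p n = 0 := fun n hn => by
    rw [← hN, hNbot] at hn
    exact hn
  have hPp : ∀ a, (p : ℤ) ^ (t - 1) • P a = 0 → redVec p a = 0 := fun a ha => by
    rw [hM] at ha
    have := hCp _ ha
    rw [← hL] at this
    have h2 : redVec p a ∈ LinearMap.ker L := this
    rwa [hLbot] at h2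
  refine ⟨pow_dvd_of_apply_eq_zero C fun n hn => (redVec_eq_zero_iff p n).1 (hCp n hn),
    pow_dvd_of_apply_eq_zero P fun n hn => (redVec_eq_zero_iff p n).1 (hPp n hn), ?_⟩
  have hdet : IsCoprime M.det ((p : ℤ) ^ t) := by
    apply IsCoprime.pow_right
    rw [isCoprime_comm, (Nat.prime_iff_prime_int.1 Fact.out).coprime_iff_not_dvd,
      ← ZMod.intCast_zmod_eq_zero_iff_dvd]
    have h1 : ((M.det : ℤ) : ZMod p) = (M.map (Int.castRingHom (ZMod p))).det :=
      RingHom.map_det (Int.castRingHom (ZMod p)) M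
    rw [h1, ← Matrix.exists_mulVec_eq_zero_iff]
    rintro ⟨v, hv0, hv⟩
    have h2 : v ∈ LinearMap.ker L := by
      rw [LinearMap.mem_ker, Matrix.toLin'_apply, hv]
    rw [hLbot] at h2
    exact hv0 h2
  obtain ⟨u, w, huw⟩ := hdet
  rintro _ ⟨n, rfl⟩
  -- Here `u` inverts `det M` modulo `p ^ t`, so `u • adj M` inverts `M` up to multiples of `p ^ t`,
  -- which `C` kills.
  refine ⟨u • (M.adjugate *ᵥ n), ?_⟩
  rw [hM, Matrix.mulVec_smul, Matrix.mulVec_mulVec, Matrix.mul_adjugate, Matrix.smul_mulVec,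
    Matrix.one_mulVec, smul_smul, map_smul]
  calc (u * M.det) • C n = (u * M.det) • C n + w • ((p : ℤ) ^ t • C n) := by
        rw [hC, smul_zero, add_zero]
    _ = C n := by rw [smul_smul, ← add_smul, huw, one_smul]

end IntegralForms

/-! ### Groups of class two and their commutator pairing. -/

section ClassTwo

open scoped Matrix commutatorElement IsMulCommutative

variable {G : Type*} [Group G]

theorem commutator_le_of_forall_gcomm_mem {H : Subgroup G} (h : ∀ x y : G, gcomm x y ∈ H) :
    commutator G ≤ H := by
  rw [commutator_def, Subgroup.commutator_le]
  intro x _ y _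
  have := h x⁻¹ y⁻¹
  simpa [gcomm, commutatorElement_def] using this

/-- The derived subgroup lies in any normal subgroup containing the commutators of generators. -/
theorem commutator_le_of_generators {S : Set G} (hS : Subgroup.closure S = ⊤) (H : Subgroup G)
    [H.Normal] (h : ∀ x ∈ S, ∀ y ∈ S, gcomm x y ∈ H) : commutator G ≤ H := by
  have hS' : Subgroup.closure (QuotientGroup.mk' H '' S) = ⊤ := by
    rw [← MonoidHom.map_closure, hS, ← MonoidHom.range_eq_map,
      MonoidHom.range_eq_top.2 (QuotientGroup.mk'_surjective H)]
  have hcomm : IsMulCommutative (Subgroup.closure (QuotientGroup.mk' H '' S)) := by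
    refine Subgroup.isMulCommutative_closure ?_
    rintro _ ⟨x, hx, rfl⟩ _ ⟨y, hy, rfl⟩
    have := h x hx y hy
    rw [← QuotientGroup.eq_one_iff] at this
    exact gcomm_eq_one_iff.1 ((map_gcomm (QuotientGroup.mk' H) x y).symm.trans this)
  refine commutator_le_of_forall_gcomm_mem fun x y => ?_
  rw [← QuotientGroup.eq_one_iff]
  refine (map_gcomm (QuotientGroup.mk' H) x y).trans (gcomm_eq_one_iff.2 ?_)
  exact congrArg Subtype.val
    (hcomm.is_comm.comm ⟨QuotientGroup.mk' H x, by rw [hS']; trivial⟩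
      ⟨QuotientGroup.mk' H y, by rw [hS']; trivial⟩)

theorem normal_of_le_center {H : Subgroup G} (h : H ≤ Subgroup.center G) : H.Normal :=
  ⟨fun n hn g => by rw [Subgroup.mem_center_iff.1 (h hn) g, mul_inv_cancel_right]; exact hn⟩

theorem gcomm_mul_left (hZ : commutator G ≤ Subgroup.center G) (x y z : G) :
    gcomm (x * y) z = gcomm x z * gcomm y z := by
  rw [gcomm_mul_left', mul_assoc y⁻¹,
    ← Subgroup.mem_center_iff.1 (hZ (gcomm_mem_commutator x z)) y, inv_mul_cancel_left]

theorem gcomm_mul_right (hZ : commutator G ≤ Subgroup.center G) (x y z : G) :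
    gcomm x (y * z) = gcomm x y * gcomm x z := by
  rw [gcomm_mul_right', mul_assoc z⁻¹,
    ← Subgroup.mem_center_iff.1 (hZ (gcomm_mem_commutator x y)) z, inv_mul_cancel_left,
    Subgroup.mem_center_iff.1 (hZ (gcomm_mem_commutator x y))]

/-- The commutator pairing of a group of class two, with values in the centre. -/
def commPairing (hZ : commutator G ≤ Subgroup.center G) :
    G →* G →* Subgroup.center G :=
  MonoidHom.mk' (fun x => MonoidHom.mk' (fun y => ⟨gcomm x y, hZ (gcomm_mem_commutator x y)⟩)
      fun y z => Subtype.ext (gcomm_mul_right hZ x y z))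
    fun x y => MonoidHom.ext fun z => Subtype.ext (gcomm_mul_left hZ x y z)

theorem coe_commPairing (hZ : commutator G ≤ Subgroup.center G) (x y : G) :
    (commPairing hZ x y : G) = gcomm x y := rfl

theorem commPairing_self (hZ : commutator G ≤ Subgroup.center G) (x : G) :
    commPairing hZ x x = 1 := Subtype.ext (gcomm_eq_one_iff.2 (Commute.refl x))

theorem commPairing_swap (hZ : commutator G ≤ Subgroup.center G) (x y : G) :
    commPairing hZ y x = (commPairing hZ x y)⁻¹ := Subtype.ext (gcomm_inv x y).symm

theorem commPairing_eq_one_iff (hZ : commutator G ≤ Subgroup.center G) {x y : G} :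
    commPairing hZ x y = 1 ↔ Commute x y := by
  rw [← gcomm_eq_one_iff, ← coe_commPairing hZ, OneMemClass.coe_eq_one]

theorem mul_pow_of_class_two (hZ : commutator G ≤ Subgroup.center G) (x y : G) (n : ℕ) :
    (x * y) ^ n = x ^ n * y ^ n * gcomm y x ^ n.choose 2 := by
  have hc : ∀ (k : ℕ) (g : G), g * gcomm y x ^ k = gcomm y x ^ k * g := fun k g =>
    Subgroup.mem_center_iff.1 (pow_mem (hZ (gcomm_mem_commutator y x)) k) g
  have hc' : ∀ g : G, Commute (gcomm y x) g := fun g => by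
    simpa [Commute, SemiconjBy] using (hc 1 g).symm
  induction n with
  | zero => simp
  | succ n ih =>
    have h1 : y ^ n * x = x * y ^ n * gcomm y x ^ n := by
      have : gcomm (y ^ n) x = gcomm y x ^ n :=
        gcomm_pow_left_of_commute (hc' y) n
      rw [← this, gcomm]
      group
    rw [pow_succ, ih, mul_assoc (x ^ n * y ^ n), ← hc, mul_assoc (x ^ n), mul_assoc x y,
      ← mul_assoc (y ^ n), h1, Nat.choose_succ_succ' n 1, Nat.choose_one_right,
      pow_add (gcomm y x), pow_succ x n, pow_succ y n]
    simp only [mul_assoc]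
    rw [← mul_assoc (gcomm y x ^ n) y, ← hc]
    simp only [mul_assoc]

/-- If `exp G'` divides `n` and `n.choose 2`, then the `n`-th power map is a homomorphism. -/
def powHomOfClassTwo (hZ : commutator G ≤ Subgroup.center G) (n : ℕ)
    (h : ∀ x y : G, gcomm x y ^ n.choose 2 = 1) : G →* G :=
  MonoidHom.mk' (fun x => x ^ n) fun x y => by rw [mul_pow_of_class_two hZ, h, mul_one]

/-- The ordered product `g₀ ^ a₀ * g₁ ^ a₁ * g₂ ^ a₂`. -/
def tupleProd (g : Fin 3 → G) (a : Fin 3 → ℤ) : G := g 0 ^ a 0 * g 1 ^ a 1 * g 2 ^ a 2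

theorem map_tupleProd {H : Type*} [Group H] (f : G →* H) (g : Fin 3 → G) (a : Fin 3 → ℤ) :
    f (tupleProd g a) = tupleProd (f ∘ g) a := by
  simp [tupleProd]

theorem tupleProd_single (g : Fin 3 → G) (i : Fin 3) : tupleProd g (Pi.single i 1) = g i := by
  fin_cases i <;> simp [tupleProd]

theorem tupleProd_smul (g : Fin 3 → G) (n : ℤ) (a : Fin 3 → ℤ) :
    tupleProd g (n • a) = tupleProd (fun i => g i ^ n) a := by
  simp [tupleProd, zpow_mul]

/-- The homomorphism `ℤ³ → Z(G)` determined by three central elements. -/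
def centralHom (v : Fin 3 → Subgroup.center G) :
    (Fin 3 → ℤ) →ₗ[ℤ] Additive (Subgroup.center G) :=
  Fintype.linearCombination ℤ (fun i => Additive.ofMul (v i))

theorem centralHom_toMul (v : Fin 3 → Subgroup.center G) (a : Fin 3 → ℤ) :
    (centralHom v a).toMul = tupleProd v a := by
  simp [centralHom, tupleProd, Fintype.linearCombination_apply, Fin.sum_univ_three]

theorem coe_centralHom (v : Fin 3 → Subgroup.center G) (a : Fin 3 → ℤ) :
    ((centralHom v a).toMul : G) = tupleProd (fun i => (v i : G)) a := by
  rw [centralHom_toMul]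
  exact map_tupleProd (Subgroup.center G).subtype v a

/-- The subgroup generated by three central elements. -/
def centralRange (v : Fin 3 → Subgroup.center G) : Subgroup G where
  carrier := {x | ∃ a, ((centralHom v a).toMul : G) = x}
  mul_mem' := by
    rintro _ _ ⟨a, rfl⟩ ⟨b, rfl⟩
    exact ⟨a + b, by rw [map_add]; rfl⟩
  one_mem' := ⟨0, by rw [map_zero]; rfl⟩
  inv_mem' := by
    rintro _ ⟨a, rfl⟩
    exact ⟨-a, by rw [map_neg]; rfl⟩

theorem centralRange_le_center (v : Fin 3 → Subgroup.center G) :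
    centralRange v ≤ Subgroup.center G := by
  rintro _ ⟨a, rfl⟩
  exact (centralHom v a).toMul.2

theorem mem_centralRange (v : Fin 3 → Subgroup.center G) (i : Fin 3) :
    (v i : G) ∈ centralRange v :=
  ⟨Pi.single i 1, by rw [coe_centralHom, tupleProd_single]⟩

/-- The three commutators of a triple of generators, in cyclic order. -/
def commTriple (hZ : commutator G ≤ Subgroup.center G) (g : Fin 3 → G) :
    Fin 3 → Subgroup.center G :=
  ![commPairing hZ (g 1) (g 2), commPairing hZ (g 2) (g 0), commPairing hZ (g 0) (g 1)]

/-- The pairing is bilinear and alternating. The cyclic order of the triple makes its coefficients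
exactly the coordinates of the cross product. -/
theorem commPairing_tupleProd (hZ : commutator G ≤ Subgroup.center G) (g : Fin 3 → G)
    (a b : Fin 3 → ℤ) :
    commPairing hZ (tupleProd g a) (tupleProd g b)
      = (centralHom (commTriple hZ g) (a ⨯₃ b)).toMul := by
  rw [centralHom_toMul]
  simp only [tupleProd, commTriple, map_mul, map_zpow, MonoidHom.mul_apply, MonoidHom.zpow_apply,
    cross_apply, Matrix.cons_val, commPairing_self, commPairing_swap hZ (g 0) (g 1),
    commPairing_swap hZ (g 1) (g 2), commPairing_swap hZ (g 2) (g 0)]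
  generalize commPairing hZ (g 0) (g 1) = u
  generalize commPairing hZ (g 1) (g 2) = v
  generalize commPairing hZ (g 2) (g 0) = w
  apply Additive.ofMul.injective
  simp only [ofMul_mul, ofMul_zpow, ofMul_inv, ofMul_one]
  module

theorem gcomm_mem_of_triple (H : Subgroup G) (g : Fin 3 → G) (h01 : gcomm (g 0) (g 1) ∈ H)
    (h02 : gcomm (g 0) (g 2) ∈ H) (h12 : gcomm (g 1) (g 2) ∈ H) :
    ∀ x ∈ Set.range g, ∀ y ∈ Set.range g, gcomm x y ∈ H := by
  have hs : ∀ x, gcomm x x ∈ H := fun x => by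
    rw [gcomm_eq_one_iff.2 (Commute.refl x)]
    exact H.one_mem
  have hi : ∀ {x y}, gcomm x y ∈ H → gcomm y x ∈ H := fun {x y} h => by
    rw [← gcomm_inv]
    exact H.inv_mem h
  rintro _ ⟨i, rfl⟩ _ ⟨j, rfl⟩
  fin_cases i <;> fin_cases j <;>
    first | exact hs _ | exact h01 | exact h02 | exact h12 | exact hi h01 | exact hi h02 |
      exact hi h12

theorem commutator_le_centralRange_commTriple (hZ : commutator G ≤ Subgroup.center G)
    (g : Fin 3 → G) (hg : Subgroup.closure (Set.range g) = ⊤) :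
    commutator G ≤ centralRange (commTriple hZ g) := by
  have := normal_of_le_center (centralRange_le_center (commTriple hZ g))
  refine commutator_le_of_generators hg _ (gcomm_mem_of_triple _ g ?_ ?_ ?_)
  · exact mem_centralRange (commTriple hZ g) 2
  · rw [← gcomm_inv]
    exact Subgroup.inv_mem _ (mem_centralRange (commTriple hZ g) 1)
  · exact mem_centralRange (commTriple hZ g) 0

/-- Modulo the derived subgroup every element is an ordered product of powers of generators. -/
theorem exists_tupleProd_mul (g : Fin 3 → G) (hg : Subgroup.closure (Set.range g) = ⊤) (x : G) :
    ∃ a, ∃ w ∈ commutator G, x = tupleProd g a * w := by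
  have key : ∃ a, Abelianization.of x = tupleProd (Abelianization.of ∘ g) a := by
    have hx : x ∈ Subgroup.closure (Set.range g) := hg ▸ Subgroup.mem_top x
    induction hx using Subgroup.closure_induction with
    | mem x hx =>
      obtain ⟨i, rfl⟩ := hx
      exact ⟨Pi.single i 1, by rw [tupleProd_single]; rfl⟩
    | one => exact ⟨0, by simp [tupleProd]⟩
    | mul x y _ _ hx hy =>
      obtain ⟨a, ha⟩ := hx
      obtain ⟨b, hb⟩ := hy
      refine ⟨a + b, ?_⟩
      rw [map_mul, ha, hb]
      simp only [tupleProd, Pi.add_apply, zpow_add]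
      simp only [mul_left_comm, mul_assoc]
    | inv x _ hx =>
      obtain ⟨a, ha⟩ := hx
      refine ⟨-a, ?_⟩
      rw [map_inv, ha]
      simp only [tupleProd, Pi.neg_apply, zpow_neg, mul_inv]
  obtain ⟨a, ha⟩ := key
  rw [← map_tupleProd] at ha
  refine ⟨a, (tupleProd g a)⁻¹ * x, ?_, by group⟩
  exact QuotientGroup.eq.1 ha.symm

theorem tupleProd_add_smul (g : Fin 3 → G) (n : ℤ) (hn : ∀ i, g i ^ n ∈ Subgroup.center G)
    (a b : Fin 3 → ℤ) : tupleProd g (a + n • b) = tupleProd g a * tupleProd g (n • b) := by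
  have h : ∀ (i : Fin 3) (k : ℤ) (x y : G), g i ^ (n * k) * (x * y) = x * (g i ^ (n * k) * y) := by
    intro i k x y
    rw [zpow_mul, ← mul_assoc, ← mul_assoc, Subgroup.mem_center_iff.1 (zpow_mem (hn i) k) x]
  simp only [tupleProd, Pi.add_apply, Pi.smul_apply, smul_eq_mul, zpow_add, mul_assoc]
  rw [h 1 (b 1) (g 2 ^ a 2), h 0 (b 0) (g 1 ^ a 1), h 0 (b 0) (g 2 ^ a 2)]

end ClassTwo

/-! ### A module with multiplication twisted by a bilinear map. -/

section TwistedModule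

variable {R V : Type*} [CommRing R] [AddCommGroup V] [Module R V]

/-- A module `V` with the multiplication `a * b = a + b + π • B a b`, where `π² = 0`. -/
@[ext]
structure TwistedModule (π : R) (B : V →ₗ[R] V →ₗ[R] V) where
  val : V

namespace TwistedModule

variable {π : R} {B : V →ₗ[R] V →ₗ[R] V}

instance : Mul (TwistedModule π B) := ⟨fun a b => ⟨a.val + b.val + π • B a.val b.val⟩⟩

instance : One (TwistedModule π B) := ⟨⟨0⟩⟩

instance : Inv (TwistedModule π B) := ⟨fun a => ⟨-a.val + π • B a.val a.val⟩⟩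

theorem val_mul (a b : TwistedModule π B) :
    (a * b).val = a.val + b.val + π • B a.val b.val := rfl

theorem val_one : (1 : TwistedModule π B).val = 0 := rfl

theorem val_inv (a : TwistedModule π B) : a⁻¹.val = -a.val + π • B a.val a.val := rfl

/-- Since `π² = 0`, nested values of `B` vanish, and both bracketings of a triple product give `a +
b + c + π (B a b + B a c + B b c)`. -/
instance [hπ : Fact (π * π = 0)] : Group (TwistedModule π B) :=
  Group.ofLeftAxioms
    (fun a b c => by
      ext
      simp only [val_mul, map_add, map_smul, LinearMap.add_apply, LinearMap.smul_apply, smul_add,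
        smul_smul, hπ.out, zero_smul]
      abel)
    (fun a => by
      ext
      simp [val_mul, val_one])
    (fun a => by
      ext
      simp only [val_mul, val_one, val_inv, map_add, map_neg, map_smul, LinearMap.add_apply,
        LinearMap.neg_apply, LinearMap.smul_apply, smul_add, smul_neg, smul_smul, hπ.out,
        zero_smul]
      abel)

instance [Finite V] : Finite (TwistedModule π B) :=
  Finite.of_injective TwistedModule.val fun _ _ h => TwistedModule.ext h

theorem natCard_eq : Nat.card (TwistedModule π B) = Nat.card V :=
  Nat.card_congr ⟨TwistedModule.val, TwistedModule.mk, fun _ => rfl, fun _ => rfl⟩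

variable [hπ : Fact (π * π = 0)]

theorem val_pow (a : TwistedModule π B) (n : ℕ) :
    (a ^ n).val = n • a.val + (n.choose 2) • π • B a.val a.val := by
  have hs : ∀ (k : ℕ) (v : V), π • k • v = k • π • v := fun k v => smul_comm _ _ _
  induction n with
  | zero => simp [val_one]
  | succ n ih =>
    rw [pow_succ, val_mul, ih]
    simp only [map_add, map_nsmul, map_smul, LinearMap.add_apply, LinearMap.smul_apply]
    rw [Nat.choose_succ_succ' n 1, Nat.choose_one_right]
    simp only [smul_add, hs, smul_smul π π, hπ.out, zero_smul, smul_zero, add_smul,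
      one_smul]
    abel

theorem val_gcomm (a b : TwistedModule π B) :
    (gcomm a b).val = π • (B a.val b.val - B b.val a.val) := by
  have h : a * b = b * a * ⟨π • (B a.val b.val - B b.val a.val)⟩ := by
    ext
    simp only [val_mul, map_add, map_sub, map_smul, smul_smul, hπ.out, zero_smul, smul_sub]
    abel
  have h2 : gcomm a b = (b * a)⁻¹ * (a * b) := by simp only [gcomm]; group
  rw [h2, h, inv_mul_cancel_left]

theorem mem_center_iff (a : TwistedModule π B) :
    a ∈ Subgroup.center (TwistedModule π B) ↔
      ∀ v, π • (B a.val v - B v a.val) = 0 := by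
  rw [Subgroup.mem_center_iff]
  have key : ∀ b, b * a = a * b ↔ π • (B a.val b.val - B b.val a.val) = 0 := fun b => by
    rw [← val_gcomm]
    have : gcomm a b = 1 ↔ (gcomm a b).val = 0 := TwistedModule.ext_iff
    rw [← this, gcomm_eq_one_iff]
    exact eq_comm
  exact ⟨fun h v => (key ⟨v⟩).1 (h ⟨v⟩), fun h b => (key b).2 (h b.val)⟩

theorem commutator_le_center :
    commutator (TwistedModule π B) ≤ Subgroup.center (TwistedModule π B) :=
  commutator_le_of_forall_gcomm_mem fun a b => by
    rw [mem_center_iff]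
    intro v
    rw [val_gcomm, map_smul, map_smul, LinearMap.smul_apply, ← smul_sub, smul_smul, hπ.out,
      zero_smul]

/-- The elements `π • v` form a homomorphic image of the additive group of `V`. -/
def smulHom :
    Multiplicative V →* TwistedModule π B :=
  MonoidHom.mk' (fun v => ⟨π • v.toAdd⟩) fun v w => by
    ext
    simp only [val_mul, toAdd_mul, map_smul, LinearMap.smul_apply, smul_smul, hπ.out, zero_smul,
      add_zero, smul_zero, smul_add]

theorem val_smulHom (v : Multiplicative V) : (smulHom (π := π) (B := B) v).val = π • v.toAdd := rfl

end TwistedModule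

end TwistedModule

/-! ### Normal form in the presented group. -/

section PresentedNormalForm

theorem mem_center_of_gcomm_generators_eq_one {G : Type*} [Group G] (g : Fin 3 → G)
    (hg : Subgroup.closure (Set.range g) = ⊤) (x : G) (hx : ∀ i, gcomm x (g i) = 1) :
    x ∈ Subgroup.center G := by
  have h : Subgroup.closure (Set.range g) ≤ Subgroup.centralizer {x} := by
    rw [Subgroup.closure_le]
    rintro _ ⟨i, rfl⟩
    exact Subgroup.mem_centralizer_singleton_iff.2 (gcomm_eq_one_iff.1 (hx i)).symm.eq
  rw [Subgroup.mem_center_iff]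
  intro y
  have hy : y ∈ Subgroup.centralizer {x} := h (hg ▸ Subgroup.mem_top y)
  exact Subgroup.mem_centralizer_singleton_iff.1 hy

/-- In a group generated by `g` whose commutators of generators are products of central powers
`g i ^ n`, every element is an ordered product of powers of the generators. -/
theorem exists_tupleProd_eq {G : Type*} [Group G] (g : Fin 3 → G)
    (hg : Subgroup.closure (Set.range g) = ⊤) (n : ℤ) (hn : ∀ i, g i ^ n ∈ Subgroup.center G)
    (h : ∀ x ∈ Set.range g, ∀ y ∈ Set.range g, ∃ m, gcomm x y = tupleProd g (n • m)) (x : G) :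
    ∃ a, x = tupleProd g a := by
  let v : Fin 3 → Subgroup.center G := fun i => ⟨g i ^ n, hn i⟩
  have hv : ∀ m, ((centralHom v m).toMul : G) = tupleProd g (n • m) := fun m => by
    rw [coe_centralHom, tupleProd_smul]
  have := normal_of_le_center (centralRange_le_center v)
  have hle : commutator G ≤ centralRange v := commutator_le_of_generators hg _ fun x hx y hy => by
    obtain ⟨m, hm⟩ := h x hx y hy
    exact ⟨m, by rw [hv, hm]⟩
  obtain ⟨a, w, hw, rfl⟩ := exists_tupleProd_mul g hg x
  obtain ⟨m, rfl⟩ := hle hw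
  exact ⟨a + n • m, by rw [hv, tupleProd_add_smul g n hn]⟩

variable (p r t : ℕ) (T : Matrix (Fin 3) (Fin 3) (ZMod (p ^ t)))

/-- The generators of `PresG p r t T`. -/
def presGen (i : Fin 3) : PresG p r t T := PresentedGroup.of i

theorem closure_range_presGen : Subgroup.closure (Set.range (presGen p r t T)) = ⊤ :=
  PresentedGroup.closure_range_of _

/-- The exponents appearing in a row word, as integers. -/
def rowExp {t p : ℕ} (v : Fin 3 → ZMod (p ^ t)) : Fin 3 → ℤ := fun i => (v i).val

/-- A triple of group elements satisfying the relations of `PresG p r t T`. -/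
structure SatisfiesRelations {G : Type*} [Group G] (g : Fin 3 → G) : Prop where
  pow_eq_one : ∀ i, g i ^ p ^ (r + t) = 1
  gcomm_pow : ∀ i j, gcomm (g i ^ p ^ t) (g j) = 1
  gcomm_zero_one : gcomm (g 0) (g 1) = tupleProd g ((p ^ r : ℤ) • rowExp (T 0))
  gcomm_zero_two : gcomm (g 0) (g 2) = tupleProd g ((p ^ r : ℤ) • rowExp (T 1))
  gcomm_one_two : gcomm (g 1) (g 2) = tupleProd g ((p ^ r : ℤ) • rowExp (T 2))

theorem lift_rowWord {G : Type*} [Group G] (g : Fin 3 → G) (v : Fin 3 → ZMod (p ^ t)) :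
    FreeGroup.lift g (rowWord p r t v) = tupleProd g ((p ^ r : ℤ) • rowExp v) := by
  have h : ∀ i, (p ^ r : ℤ) * ((v i).val : ℤ) = ((p ^ r * (v i).val : ℕ) : ℤ) := fun i => by
    push_cast
    rfl
  simp only [rowWord, map_mul, map_pow, FreeGroup.lift_apply_of, tupleProd, Pi.smul_apply, rowExp,
    smul_eq_mul, h, zpow_natCast]

theorem satisfiesRelations_iff {G : Type*} [Group G] (g : Fin 3 → G) :
    SatisfiesRelations p r t T g ↔ ∀ w ∈ presRelators p r t T, FreeGroup.lift g w = 1 := by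
  have hself : ∀ i, gcomm (g i ^ p ^ t) (g i) = 1 := fun i =>
    gcomm_eq_one_iff.2 ((Commute.refl _).pow_left _)
  simp only [presRelators, Set.mem_insert_iff, Set.mem_singleton_iff, forall_eq_or_imp, forall_eq,
    map_pow, map_mul, map_inv, map_gcomm, FreeGroup.lift_apply_of, lift_rowWord, mul_inv_eq_one]
  constructor
  · rintro ⟨h1, h2, h3, h4, h5⟩
    exact ⟨h1 0, h1 1, h1 2, h2 0 1, h2 0 2, h2 1 0, h2 1 2, h2 2 0, h2 2 1, h3, h4, h5⟩
  · rintro ⟨a, b, c, d, e, f, g', h, i, j, k, l⟩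
    refine ⟨fun i => ?_, fun i j => ?_, j, k, l⟩
    · fin_cases i <;> assumption
    · fin_cases i <;> fin_cases j <;> first | exact hself _ | assumption

theorem satisfiesRelations_presGen : SatisfiesRelations p r t T (presGen p r t T) := by
  rw [satisfiesRelations_iff]
  intro w hw
  have h : FreeGroup.lift (presGen p r t T) = PresentedGroup.mk (presRelators p r t T) := by
    ext i
    simp [presGen, PresentedGroup.of]
  rw [h]
  exact PresentedGroup.one_of_mem hw

variable {p r t T}

theorem SatisfiesRelations.pow_mem_center {G : Type*} [Group G] {g : Fin 3 → G}
    (h : SatisfiesRelations p r t T g) (hg : Subgroup.closure (Set.range g) = ⊤) (htr : t ≤ r)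
    (i : Fin 3) : g i ^ (p ^ r : ℤ) ∈ Subgroup.center G := by
  have h1 := mem_center_of_gcomm_generators_eq_one g hg _ (h.gcomm_pow i)
  have h2 : g i ^ (p ^ r : ℤ) = (g i ^ p ^ t) ^ p ^ (r - t) := by
    rw [← pow_mul, ← pow_add, Nat.add_sub_cancel' htr, ← zpow_natCast]
    push_cast
    rfl
  rw [h2]
  exact pow_mem h1 _

theorem SatisfiesRelations.exists_tupleProd_eq {G : Type*} [Group G] {g : Fin 3 → G}
    (h : SatisfiesRelations p r t T g) (hg : Subgroup.closure (Set.range g) = ⊤) (htr : t ≤ r)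
    (x : G) : ∃ a, x = tupleProd g a := by
  have hc := h.pow_mem_center hg htr
  let v : Fin 3 → Subgroup.center G := fun i => ⟨g i ^ (p ^ r : ℤ), hc i⟩
  have hv : ∀ m, ((centralHom v m).toMul : G) = tupleProd g ((p ^ r : ℤ) • m) := fun m => by
    rw [coe_centralHom, tupleProd_smul]
  refine _root_.exists_tupleProd_eq g hg (p ^ r) hc (fun x hx y hy => ?_) x
  have hm := gcomm_mem_of_triple (centralRange v) g ⟨rowExp (T 0), by rw [hv, h.gcomm_zero_one]⟩
    ⟨rowExp (T 1), by rw [hv, h.gcomm_zero_two]⟩ ⟨rowExp (T 2), by rw [hv, h.gcomm_one_two]⟩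
    x hx y hy
  obtain ⟨m, hm⟩ := hm
  exact ⟨m, by rw [← hm, hv]⟩

theorem zpow_eq_one_of_dvd {G : Type*} [Group G] {x : G} {q : ℕ} (hx : x ^ q = 1) {k : ℤ}
    (h : (q : ℤ) ∣ k) : x ^ k = 1 := by
  obtain ⟨m, rfl⟩ := h
  rw [zpow_mul, zpow_natCast, hx, one_zpow]

/-- A group with generators satisfying the relations in which no further ordered product
collapses is isomorphic to the presented group. -/
theorem SatisfiesRelations.nonempty_mulEquiv {G : Type*} [Group G] {g : Fin 3 → G}
    (h : SatisfiesRelations p r t T g) (hg : Subgroup.closure (Set.range g) = ⊤) (htr : t ≤ r)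
    (hind : ∀ a, tupleProd g a = 1 → ∀ i, ((p ^ (r + t) : ℕ) : ℤ) ∣ a i) :
    Nonempty (PresG p r t T ≃* G) := by
  let f : PresG p r t T →* G := PresentedGroup.toGroup ((satisfiesRelations_iff p r t T g).1 h)
  have hf : f ∘ presGen p r t T = g := funext fun i => PresentedGroup.toGroup.of _
  refine ⟨MulEquiv.ofBijective f ⟨?_, ?_⟩⟩
  · rw [injective_iff_map_eq_one]
    intro x hx
    obtain ⟨a, rfl⟩ := (satisfiesRelations_presGen p r t T).exists_tupleProd_eq
      (closure_range_presGen p r t T) htr x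
    rw [map_tupleProd, hf] at hx
    have hd := hind a hx
    have h1 := (satisfiesRelations_presGen p r t T).pow_eq_one
    rw [tupleProd, zpow_eq_one_of_dvd (h1 0) (hd 0), zpow_eq_one_of_dvd (h1 1) (hd 1),
      zpow_eq_one_of_dvd (h1 2) (hd 2), one_mul, one_mul]
  · rw [← MonoidHom.range_eq_top, eq_top_iff, ← hg, Subgroup.closure_le]
    rintro _ ⟨i, rfl⟩
    exact ⟨presGen p r t T i, congrFun hf i⟩

end PresentedNormalForm

/-! ### Divisibility of the binomial coefficient and a criterion for `pℰ`-groups. -/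

section Criterion

/-- This is the one place where the case `p = 2`, `t = r` must be excluded: `(2 ^ r).choose 2` has
only `r - 1` factors 2 when `r ≥ 1`. -/
theorem pow_dvd_choose_two {p r t : ℕ} (hp : p.Prime) (htr : t ≤ r)
    (h : 2 < p ∨ (p = 2 ∧ t ≠ r)) : p ^ t ∣ (p ^ r).choose 2 := by
  have h2 : 2 * (p ^ r).choose 2 = p ^ r * (p ^ r - 1) := by
    rw [Nat.choose_two_right, Nat.mul_div_cancel' (Nat.even_mul_pred_self _).two_dvd]
  rcases h with h | ⟨rfl, h⟩
  · have hc : Nat.Coprime (p ^ t) 2 :=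
      Nat.Coprime.pow_left _ ((Nat.coprime_primes hp Nat.prime_two).2 (by omega))
    refine hc.dvd_of_dvd_mul_left ?_
    rw [h2]
    exact (pow_dvd_pow p htr).mul_right _
  · have h3 : (2 ^ r).choose 2 = 2 ^ (r - 1) * (2 ^ r - 1) := by
      have : 2 ^ r = 2 * 2 ^ (r - 1) := by rw [← pow_succ', Nat.sub_add_cancel (by omega)]
      have h4 : 2 * (2 ^ r).choose 2 = 2 * (2 ^ (r - 1) * (2 ^ r - 1)) := by
        rw [h2, ← mul_assoc, ← this]
      exact Nat.eq_of_mul_eq_mul_left two_pos h4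
    rw [h3]
    exact (pow_dvd_pow 2 (by omega)).mul_right _

/-- The number `r` need only bound the exponent of `G/G'`: if that exponent is `p ^ k` with `k ≤ r`,
the generators of `Ω_k` are still killed by `p ^ r`. -/
theorem isPEGroup_of_class_two {p r : ℕ} (hp : p.Prime) {G : Type*} [Group G] [Finite G]
    (hG : IsPGroup p G) (hZ : commutator G ≤ Subgroup.center G)
    (hpow : ∀ g : G, g ^ p ^ r ∈ commutator G)
    (hcen : ∀ g : G, g ^ p ^ r = 1 → g ∈ Subgroup.center G) : IsPEGroup p G := by
  refine ⟨inferInstance, hG, fun x y => ?_, ?_⟩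
  · exact gcomm_eq_one_iff.2 (Subgroup.mem_center_iff.1 (hZ (gcomm_mem_commutator x y)) y).symm
  · have hd : Monoid.exponent (G ⧸ commutator G) ∣ p ^ r := by
      rw [Monoid.exponent_dvd_iff_forall_pow_eq_one]
      intro x
      induction x using QuotientGroup.induction_on with
      | H g => exact (QuotientGroup.eq_one_iff (g ^ p ^ r)).2 (hpow g)
    obtain ⟨k, hk, he⟩ := (Nat.dvd_prime_pow hp).1 hd
    refine ⟨k, he, ?_⟩
    rw [Omega, Subgroup.closure_le]
    intro g hg
    obtain ⟨m, hm⟩ := pow_dvd_pow p hk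
    refine hcen g ?_
    rw [hm, pow_mul, show g ^ p ^ k = 1 from hg, one_pow]

theorem isPEGroup_of_class_two_of_mulEquiv {p r : ℕ} (hp : p.Prime) {H G : Type*} [Group H]
    [Group G] [Finite G] (e : H ≃* G) (hG : IsPGroup p G)
    (hZ : commutator G ≤ Subgroup.center G) (hpow : ∀ g : G, g ^ p ^ r ∈ commutator G)
    (hcen : ∀ g : G, g ^ p ^ r = 1 → g ∈ Subgroup.center G) : IsPEGroup p H := by
  have : Finite H := Finite.of_equiv G e.symm.toEquiv
  have hc : ∀ x, e x ∈ Subgroup.center G → x ∈ Subgroup.center H := by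
    intro x hx
    rw [Subgroup.mem_center_iff] at hx ⊢
    intro y
    apply e.injective
    rw [map_mul, map_mul, hx]
  have hcomm : (commutator G).map e.symm.toMonoidHom ≤ commutator H := by
    rw [commutator_def, Subgroup.map_commutator]
    exact Subgroup.commutator_mono le_top le_top
  refine isPEGroup_of_class_two (r := r) hp (hG.of_equiv e.symm) ?_ ?_ ?_
  · refine commutator_le_of_forall_gcomm_mem fun x y => hc _ ?_
    rw [map_gcomm]
    exact hZ (gcomm_mem_commutator _ _)
  · intro x
    have := hcomm (Subgroup.mem_map_of_mem e.symm.toMonoidHom (hpow (e x)))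
    rw [← map_pow] at this
    simpa using this
  · intro x hx
    exact hc x (hcen _ (by rw [← map_pow, hx, map_one]))

end Criterion

/-! ### The concrete model of the presented group, and the converse. -/

section Model

/-- The bilinear map whose antisymmetrisation sends `(e₀, e₁)`, `(e₀, e₂)`, `(e₁, e₂)` to the rows
of `T`. -/
def rowForm {R : Type*} [CommRing R] (T : Matrix (Fin 3) (Fin 3) R) :
    (Fin 3 → R) →ₗ[R] (Fin 3 → R) →ₗ[R] (Fin 3 → R) :=
  LinearMap.mk₂ R (fun a b => -((a 1 * b 0) • T 0 + (a 2 * b 0) • T 1 + (a 2 * b 1) • T 2))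
    (by intro a a' b; simp only [Pi.add_apply]; module)
    (by intro c a b; simp only [Pi.smul_apply, smul_eq_mul]; module)
    (by intro a b b'; simp only [Pi.add_apply]; module)
    (by intro c a b; simp only [Pi.smul_apply, smul_eq_mul]; module)

theorem rowForm_apply {R : Type*} [CommRing R] (T : Matrix (Fin 3) (Fin 3) R) (a b : Fin 3 → R) :
    rowForm T a b = -((a 1 * b 0) • T 0 + (a 2 * b 0) • T 1 + (a 2 * b 1) • T 2) := rfl

theorem rowForm_single_self {R : Type*} [CommRing R] (T : Matrix (Fin 3) (Fin 3) R) (i : Fin 3) :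
    rowForm T (Pi.single i 1) (Pi.single i 1) = 0 := by
  rw [rowForm_apply]
  fin_cases i <;> simp

/-- The form is supported on pairs in decreasing order, so ordered products of generator powers
acquire no correction and their exponents are the coordinates. -/
theorem rowForm_single_of_lt {R : Type*} [CommRing R] (T : Matrix (Fin 3) (Fin 3) R) {i j : Fin 3}
    (h : i < j) : rowForm T (Pi.single i 1) (Pi.single j 1) = 0 := by
  rw [rowForm_apply]
  fin_cases i <;> fin_cases j <;> simp at h ⊢

variable (p r t : ℕ) (T : Matrix (Fin 3) (Fin 3) (ZMod (p ^ t)))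

/-- A lift of `T` to `ℤ / p ^ (r + t)`. -/
def liftMatrix : Matrix (Fin 3) (Fin 3) (ZMod (p ^ (r + t))) :=
  Matrix.of fun i j => ((T i j).val : ZMod (p ^ (r + t)))

/-- A concrete group of order `p ^ (3 * (r + t))` isomorphic to `PresG p r t T`. -/
abbrev PresModel : Type :=
  TwistedModule (p ^ r : ZMod (p ^ (r + t))) (rowForm (liftMatrix p r t T))

variable {p r t}

theorem fact_sq_eq_zero (htr : t ≤ r) :
    Fact ((p ^ r : ZMod (p ^ (r + t))) * p ^ r = 0) := ⟨by
  have h : ((p ^ (r + r) : ℕ) : ZMod (p ^ (r + t))) = 0 :=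
    (ZMod.natCast_eq_zero_iff _ _).2 (pow_dvd_pow p (by omega))
  rw [← pow_add]
  exact_mod_cast h⟩

theorem pow_mul_pow_eq_zero : (p ^ r : ZMod (p ^ (r + t))) * p ^ t = 0 := by
  have h : ((p ^ (r + t) : ℕ) : ZMod (p ^ (r + t))) = 0 := ZMod.natCast_self _
  rw [← pow_add]
  exact_mod_cast h

theorem pow_mul_intCast_eq {m n : ℤ} (h : (m : ZMod (p ^ t)) = n) :
    (p ^ r : ZMod (p ^ (r + t))) * m = p ^ r * n := by
  rw [← sub_eq_zero, ← Int.cast_sub, ZMod.intCast_zmod_eq_zero_iff_dvd] at h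
  obtain ⟨k, hk⟩ := h
  have : (m : ZMod (p ^ (r + t))) = n + p ^ t * k := by
    rw [← sub_eq_iff_eq_add', ← Int.cast_sub, hk]
    push_cast
    rfl
  rw [this, mul_add, ← mul_assoc, pow_mul_pow_eq_zero, zero_mul, add_zero]

/-- The standard generators of `PresModel p r t T`. -/
def modelGen (i : Fin 3) : PresModel p r t T := ⟨Pi.single i 1⟩

section

variable [Fact ((p ^ r : ZMod (p ^ (r + t))) * p ^ r = 0)]

theorem val_modelGen_zpow (i : Fin 3) (k : ℤ) :
    (modelGen T i ^ k : PresModel p r t T).val = (k : ZMod (p ^ (r + t))) • Pi.single i 1 := by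
  have hn : ∀ n : ℕ, (modelGen T i ^ n : PresModel p r t T).val
      = (n : ZMod (p ^ (r + t))) • Pi.single i 1 := fun n => by
    rw [TwistedModule.val_pow, modelGen, rowForm_single_self, smul_zero, smul_zero, add_zero,
      Nat.cast_smul_eq_nsmul]
  obtain ⟨n, rfl | rfl⟩ := k.eq_nat_or_neg
  · rw [zpow_natCast, hn, Int.cast_natCast]
  · rw [zpow_neg, zpow_natCast, TwistedModule.val_inv, hn, map_smul, map_smul,
      LinearMap.smul_apply, rowForm_single_self, smul_zero, smul_zero, smul_zero, add_zero,
      Int.cast_neg, neg_smul, Int.cast_natCast]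

theorem val_tupleProd_modelGen (a : Fin 3 → ℤ) :
    (tupleProd (modelGen (p := p) (r := r) T) a).val = fun i => (a i : ZMod (p ^ (r + t))) := by
  simp only [tupleProd, TwistedModule.val_mul, val_modelGen_zpow, map_add, map_smul,
    LinearMap.add_apply, LinearMap.smul_apply, rowForm_single_of_lt _ (show (0 : Fin 3) < 1 by decide),
    rowForm_single_of_lt _ (show (0 : Fin 3) < 2 by decide),
    rowForm_single_of_lt _ (show (1 : Fin 3) < 2 by decide), smul_zero, add_zero]
  ext i
  fin_cases i <;> simp

theorem exists_tupleProd_modelGen_eq (x : PresModel p r t T) :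
    ∃ a, x = tupleProd (modelGen T) a := by
  choose a ha using fun i => ZMod.intCast_surjective (x.val i)
  refine ⟨a, TwistedModule.ext ?_⟩
  rw [val_tupleProd_modelGen]
  exact (funext ha).symm

theorem closure_range_modelGen :
    Subgroup.closure (Set.range (modelGen (p := p) (r := r) T)) = ⊤ := by
  rw [eq_top_iff]
  intro x _
  obtain ⟨a, rfl⟩ := exists_tupleProd_modelGen_eq T x
  have h : ∀ i, modelGen T i ∈ Subgroup.closure (Set.range (modelGen (p := p) (r := r) T)) :=
    fun i => Subgroup.subset_closure ⟨i, rfl⟩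
  exact mul_mem (mul_mem (zpow_mem (h 0) _) (zpow_mem (h 1) _)) (zpow_mem (h 2) _)

theorem val_gcomm_modelGen :
    (gcomm (modelGen (p := p) (r := r) T 0) (modelGen T 1)).val
      = (p ^ r : ZMod (p ^ (r + t))) • liftMatrix p r t T 0 ∧
    (gcomm (modelGen (p := p) (r := r) T 0) (modelGen T 2)).val
      = (p ^ r : ZMod (p ^ (r + t))) • liftMatrix p r t T 1 ∧
    (gcomm (modelGen (p := p) (r := r) T 1) (modelGen T 2)).val
      = (p ^ r : ZMod (p ^ (r + t))) • liftMatrix p r t T 2 := by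
  simp [TwistedModule.val_gcomm, modelGen, rowForm_apply]

theorem satisfiesRelations_modelGen :
    SatisfiesRelations p r t T (modelGen (p := p) (r := r) T) := by
  have hrow : ∀ k, (tupleProd (modelGen (p := p) (r := r) T) ((p ^ r : ℤ) • rowExp (T k))).val
      = (p ^ r : ZMod (p ^ (r + t))) • liftMatrix p r t T k := fun k => by
    rw [val_tupleProd_modelGen]
    ext i
    simp [rowExp, liftMatrix]
  obtain ⟨h1, h2, h3⟩ := val_gcomm_modelGen (p := p) (r := r) T
  refine ⟨fun i => TwistedModule.ext ?_, fun i j => TwistedModule.ext ?_, ?_, ?_, ?_⟩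
  · rw [← zpow_natCast, val_modelGen_zpow, Int.cast_natCast, ZMod.natCast_self, zero_smul]
    rfl
  · rw [← zpow_natCast, TwistedModule.val_gcomm, val_modelGen_zpow, map_smul, map_smul,
      LinearMap.smul_apply, ← smul_sub, smul_smul]
    have : (p ^ r : ZMod (p ^ (r + t))) * ((p ^ t : ℕ) : ℤ) = 0 := by
      push_cast
      exact pow_mul_pow_eq_zero
    rw [this, zero_smul]
    rfl
  · exact TwistedModule.ext (by rw [h1, hrow])
  · exact TwistedModule.ext (by rw [h2, hrow])
  · exact TwistedModule.ext (by rw [h3, hrow])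

theorem nonempty_presG_mulEquiv_model (htr : t ≤ r) :
    Nonempty (PresG p r t T ≃* PresModel p r t T) := by
  refine (satisfiesRelations_modelGen T).nonempty_mulEquiv (closure_range_modelGen T) htr ?_
  intro a ha i
  have := congrArg TwistedModule.val ha
  rw [val_tupleProd_modelGen] at this
  exact (ZMod.intCast_zmod_eq_zero_iff_dvd _ _).1 (congrFun this i)

end

theorem natCard_presModel : Nat.card (PresModel p r t T) = p ^ (3 * (r + t)) := by
  rw [TwistedModule.natCard_eq, Nat.card_fun, Nat.card_zmod, Nat.card_eq_fintype_card,
    Fintype.card_fin, ← pow_mul, mul_comm]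

theorem natCard_presG (htr : t ≤ r) : Nat.card (PresG p r t T) = p ^ (3 * (r + t)) := by
  have := fact_sq_eq_zero (p := p) htr
  obtain ⟨e⟩ := nonempty_presG_mulEquiv_model T htr
  rw [Nat.card_congr e.toEquiv, natCard_presModel]

theorem isPEGroup_of_mulEquiv_presG (hp : p.Prime) (htr : t ≤ r)
    (h : 2 < p ∨ (p = 2 ∧ t ≠ r)) (T : Matrix.GeneralLinearGroup (Fin 3) (ZMod (p ^ t)))
    {H : Type*} [Group H] (e : H ≃* PresG p r t (T : Matrix (Fin 3) (Fin 3) (ZMod (p ^ t)))) :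
    IsPEGroup p H := by
  have := fact_sq_eq_zero (p := p) htr
  have : NeZero (p ^ (r + t)) := ⟨pow_ne_zero _ hp.ne_zero⟩
  have : NeZero (p ^ t) := ⟨pow_ne_zero _ hp.ne_zero⟩
  set M := (T : Matrix (Fin 3) (Fin 3) (ZMod (p ^ t))) with hM
  obtain ⟨e'⟩ := nonempty_presG_mulEquiv_model M htr
  -- The correction term carries `(p ^ r).choose 2 * p ^ r`, which is divisible by `p ^ (r + t)`.
  have hpw : ∀ x : PresModel p r t M,
      (x ^ p ^ r).val = (p ^ r : ZMod (p ^ (r + t))) • x.val := by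
    intro x
    obtain ⟨k, hk⟩ := pow_dvd_choose_two hp htr h
    rw [TwistedModule.val_pow, hk, ← Nat.cast_smul_eq_nsmul (ZMod (p ^ (r + t))),
      ← Nat.cast_smul_eq_nsmul (ZMod (p ^ (r + t))), smul_smul]
    have : ((p ^ t * k : ℕ) : ZMod (p ^ (r + t))) * p ^ r = 0 := by
      push_cast
      rw [mul_right_comm, mul_comm ((p : ZMod (p ^ (r + t))) ^ t), pow_mul_pow_eq_zero, zero_mul]
    rw [this, zero_smul, add_zero, Nat.cast_pow]
  refine isPEGroup_of_class_two_of_mulEquiv (r := r) hp (e.trans e')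
    (IsPGroup.of_card (natCard_presModel M)) TwistedModule.commutator_le_center ?_ ?_
  · intro x
    choose a ha using fun i => ZMod.intCast_surjective (x.val i)
    -- Invertibility of `T` lets `x` be written modulo `p ^ t` as a combination of the rows. After
    -- multiplication by `p ^ r` this expresses `x ^ p ^ r` through the commutators of generators.
    let c : Fin 3 → ZMod (p ^ t) := Matrix.vecMul (fun i => (a i : ZMod (p ^ t))) (T⁻¹).1
    have hc : Matrix.vecMul c M = fun i => (a i : ZMod (p ^ t)) := by
      rw [Matrix.vecMul_vecMul, hM, ← Units.val_mul, inv_mul_cancel, Units.val_one,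
        Matrix.vecMul_one]
    obtain ⟨h1, h2, h3⟩ := val_gcomm_modelGen (p := p) (r := r) M
    let D := TwistedModule.smulHom (π := (p ^ r : ZMod (p ^ (r + t)))) (B := rowForm (liftMatrix p r t M))
    have hx : x ^ p ^ r = D (Multiplicative.ofAdd (liftMatrix p r t M 0)) ^ (c 0).val *
        D (Multiplicative.ofAdd (liftMatrix p r t M 1)) ^ (c 1).val *
        D (Multiplicative.ofAdd (liftMatrix p r t M 2)) ^ (c 2).val := by
      rw [← map_pow D, ← map_pow D, ← map_pow D, ← map_mul D, ← map_mul D]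
      ext i
      rw [hpw, TwistedModule.val_smulHom]
      have hi := congrFun hc i
      simp only [Matrix.vecMul, dotProduct, Fin.sum_univ_three] at hi
      have h4 := pow_mul_intCast_eq (p := p) (r := r) (t := t) (m := a i)
        (n := (c 0).val * (M 0 i).val + (c 1).val * (M 1 i).val + (c 2).val * (M 2 i).val) (by
          rw [← hi]
          push_cast
          simp only [ZMod.natCast_zmod_val])
      rw [Pi.smul_apply, ← ha, smul_eq_mul, h4]
      simp [liftMatrix, -ZMod.natCast_val]
    rw [hx]
    have hmem : ∀ k, (∃ y z : PresModel p r t M, (gcomm y z).val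
        = (p ^ r : ZMod (p ^ (r + t))) • liftMatrix p r t M k) →
        D (Multiplicative.ofAdd (liftMatrix p r t M k)) ∈ commutator (PresModel p r t M) := by
      rintro k ⟨y, z, hyz⟩
      have : D (Multiplicative.ofAdd (liftMatrix p r t M k)) = gcomm y z :=
        TwistedModule.ext hyz.symm
      rw [this]
      exact gcomm_mem_commutator y z
    exact mul_mem (mul_mem (pow_mem (hmem 0 ⟨_, _, h1⟩) _) (pow_mem (hmem 1 ⟨_, _, h2⟩) _))
      (pow_mem (hmem 2 ⟨_, _, h3⟩) _)
  · intro x hx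
    rw [TwistedModule.mem_center_iff]
    intro v
    have := hpw x
    rw [hx] at this
    rw [smul_sub, ← LinearMap.map_smul₂, ← map_smul, ← this, TwistedModule.val_one, map_zero,
      LinearMap.zero_apply, map_zero, sub_zero]

end Model

/-! ### Three-generator 2-Engel groups: reduction to class two. -/

section EngelThreeGenerator

variable {G : Type*} [Group G]

/-- Triple commutators are alternating: a repeated index gives 1, and a permutation of the three
indices gives the generator or its inverse. -/
theorem engel_triple_mem_zpowers (hE : ∀ x y : G, gcomm (gcomm x y) y = 1) (g : Fin 3 → G)
    (i j k : Fin 3) :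
    gcomm (gcomm (g i) (g j)) (g k) ∈ Subgroup.zpowers (gcomm (gcomm (g 0) (g 1)) (g 2)) := by
  set U := Subgroup.zpowers (gcomm (gcomm (g 0) (g 1)) (g 2)) with hU
  have hr : ∀ {x y z : G}, gcomm (gcomm x y) z ∈ U → gcomm (gcomm x z) y ∈ U := fun {x y z} h => by
    rw [engel_swap_right hE]
    exact inv_mem h
  have hl : ∀ {x y z : G}, gcomm (gcomm x y) z ∈ U → gcomm (gcomm y x) z ∈ U := fun {x y z} h => by
    rw [engel_swap_left hE]
    exact inv_mem h
  have h1 : ∀ x y : G, gcomm (gcomm x y) y ∈ U := fun x y => by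
    rw [hE]
    exact one_mem _
  have h2 : ∀ x y : G, gcomm (gcomm y x) y ∈ U := fun x y => hl (h1 x y)
  have h3 : ∀ x y : G, gcomm (gcomm x x) y ∈ U := fun x y => hr (h2 y x)
  have h : gcomm (gcomm (g 0) (g 1)) (g 2) ∈ U := Subgroup.mem_zpowers _
  have hcases : ∀ l : Fin 3, l = 0 ∨ l = 1 ∨ l = 2 := by decide
  rcases hcases i with rfl | rfl | rfl <;> rcases hcases j with rfl | rfl | rfl <;>
    rcases hcases k with rfl | rfl | rfl <;> with_reducible
    first
    | exact h1 _ _ | exact h2 _ _ | exact h3 _ _ | exact h | exact hr h | exact hl h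
    | exact hl (hr h) | exact hr (hl h) | exact hr (hl (hr h))

theorem gcomm_mem_of_triple_mem (g : Fin 3 → G) (hg : Subgroup.closure (Set.range g) = ⊤)
    (U : Subgroup G) [U.Normal] (h : ∀ i j k, gcomm (gcomm (g i) (g j)) (g k) ∈ U) {c : G}
    (hc : c ∈ commutator G) (b : G) : gcomm c b ∈ U := by
  have hg' : Subgroup.closure (Set.range (QuotientGroup.mk' U ∘ g)) = ⊤ := by
    rw [Set.range_comp, ← MonoidHom.map_closure, hg, ← MonoidHom.range_eq_map,
      MonoidHom.range_eq_top.2 (QuotientGroup.mk'_surjective U)]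
  have hQ : commutator (G ⧸ U) ≤ Subgroup.center (G ⧸ U) := by
    refine commutator_le_of_generators hg' _ ?_
    rintro _ ⟨i, rfl⟩ _ ⟨j, rfl⟩
    refine mem_center_of_gcomm_generators_eq_one _ hg' _ fun k => ?_
    simp only [Function.comp_apply, ← map_gcomm]
    exact (QuotientGroup.eq_one_iff _).2 (h i j k)
  have hmap : (commutator G).map (QuotientGroup.mk' U) ≤ commutator (G ⧸ U) := by
    rw [commutator_def, Subgroup.map_commutator]
    exact Subgroup.commutator_mono le_top le_top
  have hc' := hQ (hmap (Subgroup.mem_map_of_mem _ hc))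
  rw [← QuotientGroup.eq_one_iff]
  refine (map_gcomm (QuotientGroup.mk' U) c b).trans (gcomm_eq_one_iff.2 ?_)
  exact (Subgroup.mem_center_iff.1 hc' _).symm

/-- A `3`-generator `2`-Engel group in which `n`-th powers lie in the derived subgroup and elements
of order dividing `n` are central has class at most two. -/
theorem commutator_le_center_of_engel (hE : ∀ x y : G, gcomm (gcomm x y) y = 1) (g : Fin 3 → G)
    (hg : Subgroup.closure (Set.range g) = ⊤) {n : ℕ} (hn : ∀ x : G, x ^ n ∈ commutator G)
    (hcen : ∀ x : G, x ^ n = 1 → x ∈ Subgroup.center G) : commutator G ≤ Subgroup.center G := by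
  set u := gcomm (gcomm (g 0) (g 1)) (g 2) with hu
  have hUZ : Subgroup.zpowers u ≤ Subgroup.center G := by
    rw [Subgroup.zpowers_le, Subgroup.mem_center_iff]
    exact fun y => (gcomm_eq_one_iff.1 (engel_gcomm_four hE _ _ _ y)).eq.symm
  have := normal_of_le_center hUZ
  have hU : ∀ c ∈ commutator G, ∀ b, gcomm c b ∈ Subgroup.zpowers u := fun c hc b =>
    gcomm_mem_of_triple_mem g hg _ (engel_triple_mem_zpowers hE g) hc b
  have hu1 : u = 1 := by
    set c := g 0 ^ n with hc
    have hcU : ∀ b, gcomm c b ∈ Subgroup.zpowers u := hU c (hn _)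
    have hcm : ∀ b b', gcomm c (b * b') = gcomm c b * gcomm c b' := fun b b' => by
      rw [gcomm_mul_right', mul_assoc b'⁻¹, ← Subgroup.mem_center_iff.1 (hUZ (hcU b)) b',
        inv_mul_cancel_left, Subgroup.mem_center_iff.1 (hUZ (hcU b))]
    have hcz : ∀ (k : ℤ) b, gcomm c (b ^ k) = gcomm c b ^ k := fun k b =>
      map_zpow (MonoidHom.mk' (gcomm c) hcm) b k
    have hz : ∀ b, gcomm c b = 1 → gcomm (g 0) b ∈ Subgroup.center G := fun b hb => by
      refine hcen _ ?_
      rw [← gcomm_pow_left_of_commute (engel_commute_left hE _ _), hb]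
    -- Swapping the last two entries gives `[[g₀,g₁],b] = [[g₀,b],g₁]⁻¹`, which is trivial because
    -- `[g₀,b]` is central.
    have hgood : ∀ b, gcomm c b = 1 → gcomm (gcomm (g 0) (g 1)) b = 1 := fun b hb => by
      rw [engel_swap_right hE, inv_eq_one, gcomm_eq_one_iff]
      exact (Subgroup.mem_center_iff.1 (hz b hb) _).symm
    obtain ⟨i, hi⟩ := Subgroup.mem_zpowers_iff.1 (hcU (g 1))
    obtain ⟨j, hj⟩ := Subgroup.mem_zpowers_iff.1 (hcU (g 2))
    have hu3 : u ^ 3 = 1 := engel_gcomm_pow_three hE _ _ _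
    by_cases h3 : (3 : ℤ) ∣ i
    · have h1 : gcomm c (g 1) = 1 := by
        rw [← hi]
        exact zpow_eq_one_of_dvd hu3 h3
      rw [hu, gcomm_eq_one_iff]
      exact (Subgroup.mem_center_iff.1 (hz _ h1) _).symm
    · have h1 : gcomm c (g 1 ^ (-(i * j)) * g 2) = 1 := by
        rw [hcm, hcz, ← hi, ← hj, ← zpow_mul, ← zpow_add]
        refine zpow_eq_one_of_dvd hu3 ?_
        have h4 : (3 : ℤ) ∣ 1 - i * i := by
          have h5 : i % 3 = 1 ∨ i % 3 = 2 := by omega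
          rw [Int.dvd_iff_emod_eq_zero, Int.sub_emod, Int.mul_emod]
          rcases h5 with h5 | h5 <;> rw [h5] <;> rfl
        have h6 : i * -(i * j) + j = (1 - i * i) * j := by ring
        rw [h6]
        exact h4.mul_right j
      have h2 := gcomm_eq_one_iff.1 (hgood _ h1)
      have h3 : Commute (gcomm (g 0) (g 1)) (g 1 ^ (-(i * j))) :=
        (engel_commute_right hE _ _).zpow_right _
      rw [hu, gcomm_eq_one_iff]
      have h4 := h3.inv_right.mul_right h2
      rwa [inv_mul_cancel_left] at h4
  intro x hx
  rw [Subgroup.mem_center_iff]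
  intro y
  have h := hU x hx y
  rw [hu1, Subgroup.zpowers_one_eq_bot, Subgroup.mem_bot] at h
  exact (gcomm_eq_one_iff.1 h).eq.symm

end EngelThreeGenerator

/-! ### Recovering the presentation from a class-two group. -/

section Classification

open scoped Matrix IsMulCommutative

variable {G : Type*} [Group G]

theorem smul_centralHom_eq_zero {v : Fin 3 → Subgroup.center G} {n : ℕ} (h : ∀ i, v i ^ n = 1)
    (a : Fin 3 → ℤ) : (n : ℤ) • centralHom v a = 0 := by
  rw [← map_smul]
  apply Additive.toMul.injective
  rw [centralHom_toMul, tupleProd_smul]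
  simp [h, tupleProd]

theorem centralHom_eq_zero_iff {v : Fin 3 → Subgroup.center G} {a : Fin 3 → ℤ} :
    centralHom v a = 0 ↔ tupleProd (fun i => (v i : G)) a = 1 := by
  rw [← coe_centralHom, OneMemClass.coe_eq_one]
  rfl

/-- If the `p ^ r`-th powers of three elements are independent of order `p ^ t`, then the elements
themselves are independent of order `p ^ (r + t)`. -/
theorem tupleProd_dvd_of_eq_one {p r t : ℕ} (ht : 1 ≤ t) (htr : t ≤ r) (g : Fin 3 → G)
    (hcen : ∀ i, g i ^ p ^ t ∈ Subgroup.center G)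
    (hbase : ∀ a, tupleProd g a = 1 → tupleProd (fun i => g i ^ p ^ r) a = 1)
    (hind : ∀ a, tupleProd (fun i => g i ^ p ^ r) a = 1 → ∀ i, (p : ℤ) ^ t ∣ a i)
    (a : Fin 3 → ℤ) (ha : tupleProd g a = 1) (i : Fin 3) : (p : ℤ) ^ (r + t) ∣ a i := by
  -- Once `a = p ^ s • b`, the factors `g i ^ p ^ s` are central, so the relation may be raised to
  -- the power `p ^ (r - s)` termwise. This gives a relation `b` among the `p ^ r`-th powers and a
  -- further factor `p ^ t`. Iterating up to `s = r` yields `p ^ (r + t)`.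
  have hstep : ∀ s, t ≤ s → s ≤ r → (∀ i, (p : ℤ) ^ s ∣ a i) → ∀ i, (p : ℤ) ^ (s + t) ∣ a i := by
    intro s hts hsr hs
    obtain ⟨b, rfl⟩ := exists_smul_of_forall_dvd hs
    have hcs : ∀ i, g i ^ p ^ s ∈ Subgroup.center G := fun i => by
      rw [← Nat.sub_add_cancel hts, add_comm, pow_add, pow_mul]
      exact pow_mem (hcen i) _
    let w : Fin 3 → Subgroup.center G := fun i => ⟨g i ^ p ^ s, hcs i⟩
    have hw : centralHom w b = 0 := by
      rw [centralHom_eq_zero_iff, ← ha, tupleProd_smul]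
      simp only [w, ← Nat.cast_pow, zpow_natCast]
    have hb : tupleProd (fun i => g i ^ p ^ r) b = 1 := by
      have h1 : centralHom w (((p ^ (r - s) : ℕ) : ℤ) • b) = 0 := by
        rw [map_smul, hw, smul_zero]
      rw [centralHom_eq_zero_iff, tupleProd_smul] at h1
      rw [← h1]
      simp only [w, zpow_natCast, ← pow_mul, ← pow_add, Nat.add_sub_cancel' hsr]
    intro i
    rw [pow_add]
    exact mul_dvd_mul_left _ (hind b hb i)
  have key : ∀ s, t ≤ s → s ≤ r → ∀ i, (p : ℤ) ^ s ∣ a i := by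
    intro s hts
    induction s, hts using Nat.le_induction with
    | base => intro _; exact hind a (hbase a ha)
    | succ s hts ih =>
      intro hsr i
      exact (pow_dvd_pow _ (by omega)).trans (hstep s hts (by omega) (ih (by omega)) i)
  exact hstep r htr le_rfl (key r htr le_rfl) i

theorem centralHom_congr {v : Fin 3 → Subgroup.center G} {q : ℕ}
    (h : ∀ a, (q : ℤ) • centralHom v a = 0) {m n : Fin 3 → ℤ}
    (hmn : ∀ i, (m i : ZMod q) = n i) : centralHom v m = centralHom v n := by
  obtain ⟨k, hk⟩ := exists_smul_of_forall_dvd (q := q) (n := m - n) fun i =>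
    (ZMod.intCast_zmod_eq_zero_iff_dvd _ _).1 (by rw [Pi.sub_apply, Int.cast_sub, hmn, sub_self])
  rw [← sub_eq_zero, ← map_sub, hk, map_smul, h]

theorem exists_presentation_of_class_two {p r t : ℕ} (hp : p.Prime) (g : Fin 3 → G)
    (hg : Subgroup.closure (Set.range g) = ⊤) (hZ : commutator G ≤ Subgroup.center G)
    (ht : 1 ≤ t) (htr : t ≤ r) (hpt : 2 < p ∨ (p = 2 ∧ t ≠ r))
    (hexp : Monoid.exponent (commutator G) = p ^ t) (hpow : ∀ x : G, x ^ p ^ r ∈ commutator G)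
    (hcen : ∀ x : G, x ^ p ^ r = 1 → x ∈ Subgroup.center G) :
    ∃ T : Matrix.GeneralLinearGroup (Fin 3) (ZMod (p ^ t)),
      Nonempty (PresG p r t (T : Matrix (Fin 3) (Fin 3) (ZMod (p ^ t))) ≃* G) := by
  have : Fact p.Prime := ⟨hp⟩
  have : NeZero (p ^ t) := ⟨pow_ne_zero _ hp.ne_zero⟩
  have hkill : ∀ w ∈ commutator G, w ^ p ^ t = 1 := fun w hw => by
    have := Monoid.pow_exponent_eq_one (⟨w, hw⟩ : commutator G)
    rw [hexp] at this
    exact congrArg Subtype.val this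
  have hchoose : ∀ x y : G, gcomm x y ^ (p ^ r).choose 2 = 1 := fun x y => by
    obtain ⟨k, hk⟩ := pow_dvd_choose_two hp htr hpt
    rw [hk, pow_mul, hkill _ (gcomm_mem_commutator x y), one_pow]
  let φ := powHomOfClassTwo hZ (p ^ r) hchoose
  have hφ : ∀ a, (tupleProd g a) ^ p ^ r = tupleProd (fun i => g i ^ p ^ r) a :=
    map_tupleProd φ g
  let v : Fin 3 → Subgroup.center G := fun i => ⟨g i ^ p ^ r, hZ (hpow _)⟩
  have hC : ∀ n, (p : ℤ) ^ t • centralHom (commTriple hZ g) n = 0 := fun n => by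
    rw [← Nat.cast_pow]
    refine smul_centralHom_eq_zero (fun i => Subtype.ext ?_) n
    fin_cases i <;> exact hkill _ (gcomm_mem_commutator _ _)
  have hP : ∀ n, (p : ℤ) ^ t • centralHom v n = 0 := fun n => by
    rw [← Nat.cast_pow]
    exact smul_centralHom_eq_zero (fun i => Subtype.ext (hkill _ (hpow _))) n
  have hP' : ∀ n, ((p ^ t : ℕ) : ℤ) • centralHom v n = 0 := fun n => by
    rw [Nat.cast_pow]
    exact hP n
  have hle := commutator_le_centralRange_commTriple hZ g hg
  have hPC : LinearMap.range (centralHom v) ≤ LinearMap.range (centralHom (commTriple hZ g)) := by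
    rintro _ ⟨a, rfl⟩
    have : ((centralHom v a).toMul : G) ∈ commutator G := by
      rw [coe_centralHom, ← hφ]
      exact hpow _
    obtain ⟨n, hn⟩ := hle this
    exact ⟨n, Additive.toMul.injective (Subtype.ext hn)⟩
  have hC' : ∃ n, (p : ℤ) ^ (t - 1) • centralHom (commTriple hZ g) n ≠ 0 := by
    by_contra! hcon
    have hd : Monoid.exponent (commutator G) ∣ p ^ (t - 1) := by
      rw [Monoid.exponent_dvd_iff_forall_pow_eq_one]
      rintro ⟨w, hw⟩
      obtain ⟨n, rfl⟩ := hle hw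
      have h1 := congrArg Additive.toMul (hcon n)
      rw [← Nat.cast_pow, natCast_zsmul, toMul_nsmul] at h1
      have h2 := congrArg Subtype.val h1
      exact Subtype.ext h2
    rw [hexp, Nat.pow_dvd_pow_iff_le_right hp.one_lt] at hd
    omega
  have hcross : ∀ a, centralHom v a = 0 → ∀ b, centralHom (commTriple hZ g) (a ⨯₃ b) = 0 := by
    intro a ha b
    rw [centralHom_eq_zero_iff] at ha
    have h1 := hcen _ ((hφ a).trans ha)
    apply Additive.toMul.injective
    rw [← commPairing_tupleProd]
    exact (commPairing_eq_one_iff hZ).2 (Subgroup.mem_center_iff.1 h1 _).symm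
  obtain ⟨-, hPind, hCP⟩ := independent_of_cross_relations ht (centralHom (commTriple hZ g))
    (centralHom v) hPC hC hC' hcross
  obtain ⟨M, hM⟩ := exists_matrix_of_range_le _ _ hPC
  obtain ⟨N, hN⟩ := exists_matrix_of_range_le _ _ hCP
  have hNM : N.map (Int.castRingHom (ZMod (p ^ t))) * M.map (Int.castRingHom (ZMod (p ^ t))) = 1 := by
    have h1 : (N * M).map (Int.castRingHom (ZMod (p ^ t)))
        = (1 : Matrix (Fin 3) (Fin 3) ℤ).map (Int.castRingHom (ZMod (p ^ t))) := by
      ext i j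
      have h2 := hPind ((N * M - 1) *ᵥ Pi.single j 1) (by
        rw [Matrix.sub_mulVec, map_sub, Matrix.one_mulVec, ← Matrix.mulVec_mulVec, ← hN, ← hM,
          sub_self]) i
      rw [Matrix.mulVec_single_one, Matrix.col_apply, Matrix.sub_apply, ← Nat.cast_pow,
        ← ZMod.intCast_zmod_eq_zero_iff_dvd, Int.cast_sub, sub_eq_zero] at h2
      exact h2
    rw [← Matrix.map_mul, h1, Matrix.map_one _ (map_zero _) (map_one _)]
  have hdetN : IsUnit (N.map (Int.castRingHom (ZMod (p ^ t)))).det :=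
    IsUnit.of_mul_eq_one _ (by rw [← Matrix.det_mul, hNM, Matrix.det_one])
  -- The columns of `N` express `[g₁,g₂]`, `[g₂,g₀]`, `[g₀,g₁]`. The presentation lists `[g₀,g₁]`,
  -- `[g₀,g₂]`, `[g₁,g₂]`, whence the reversed order and the middle sign; the two sign changes of
  -- the determinant cancel.
  let T₀ : Matrix (Fin 3) (Fin 3) (ZMod (p ^ t)) :=
    Matrix.of ![fun j => (N j 2 : ZMod (p ^ t)), fun j => -(N j 1 : ZMod (p ^ t)),
      fun j => (N j 0 : ZMod (p ^ t))]
  have hdetT : IsUnit T₀.det := by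
    have : T₀.det = (N.map (Int.castRingHom (ZMod (p ^ t)))).det := by
      rw [Matrix.det_fin_three, Matrix.det_fin_three]
      simp only [T₀, Matrix.of_apply, Matrix.cons_val, Matrix.map_apply, eq_intCast]
      ring
    rw [this]
    exact hdetN
  have hrow : ∀ (k : Fin 3) (m : Fin 3 → ℤ), (∀ i, (m i : ZMod (p ^ t)) = T₀ k i) →
      tupleProd g ((p ^ r : ℤ) • rowExp (T₀ k)) = ((centralHom v m).toMul : G) := by
    intro k m hm
    have h1 : centralHom v m = centralHom v (rowExp (T₀ k)) := centralHom_congr hP' fun i => by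
      rw [hm, rowExp, Int.cast_natCast, ZMod.natCast_zmod_val]
    rw [h1, coe_centralHom, tupleProd_smul]
    simp only [v, ← Nat.cast_pow, zpow_natCast]
  have hcol : ∀ k, centralHom v (fun j => N j k) = Additive.ofMul (commTriple hZ g k) := fun k => by
    have h1 := hN (Pi.single k 1)
    rw [Matrix.mulVec_single_one] at h1
    have h2 : N.col k = fun j => N j k := rfl
    rw [← h2, ← h1]
    exact Additive.toMul.injective (by rw [centralHom_toMul, tupleProd_single]; rfl)
  have hrel : SatisfiesRelations p r t T₀ g := by
    refine ⟨fun i => ?_, fun i j => ?_, ?_, ?_, ?_⟩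
    · rw [pow_add, pow_mul]
      exact hkill _ (hpow _)
    · have hc : Commute (gcomm (g i) (g j)) (g i) :=
        (Subgroup.mem_center_iff.1 (hZ (gcomm_mem_commutator _ _)) _).symm
      rw [gcomm_pow_left_of_commute hc]
      exact hkill _ (gcomm_mem_commutator _ _)
    · rw [hrow 0 (fun j => N j 2) fun i => rfl, hcol]
      rfl
    · rw [hrow 1 (-fun j => N j 1) fun i => Int.cast_neg _, map_neg, hcol, ← gcomm_inv]
      rfl
    · rw [hrow 2 (fun j => N j 0) fun i => rfl, hcol]
      rfl
  refine ⟨Matrix.GeneralLinearGroup.mk'' T₀ hdetT, ?_⟩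
  refine hrel.nonempty_mulEquiv hg htr fun a ha i => ?_
  rw [Nat.cast_pow]
  refine tupleProd_dvd_of_eq_one ht htr g
    (fun i => mem_center_of_gcomm_generators_eq_one g hg _ (hrel.gcomm_pow i)) (fun a ha => ?_)
    (fun a ha => hPind a (centralHom_eq_zero_iff.2 ha)) a ha i
  rw [← hφ, ha, one_pow]

end Classification

/-! ### The classification theorem. -/

theorem theorem2p2 (p : ℕ) (hp : p.Prime) :
    (∀ (G : Type*) [Group G], IsPEGroup p G → IsThreeGenerator G →
      ¬ (∀ a b : G, a * b = b * a) →
      ∀ r t : ℕ, Monoid.exponent (G ⧸ commutator G) = p ^ r →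
        Monoid.exponent (commutator G) = p ^ t →
        (2 < p ∨ (p = 2 ∧ Monoid.exponent (commutator G) ≠ 2 ^ r)) →
        (1 ≤ t ∧ t ≤ r) ∧ Nat.card G = p ^ (3 * (r + t)) ∧
          ∃ T : Matrix.GeneralLinearGroup (Fin 3) (ZMod (p ^ t)),
            Nonempty (G ≃* PresG p r t (T : Matrix (Fin 3) (Fin 3) (ZMod (p ^ t))))) ∧
    (∀ (r t : ℕ), 1 ≤ t → t ≤ r → (2 < p ∨ (p = 2 ∧ t ≠ r)) →
      ∀ (T : Matrix.GeneralLinearGroup (Fin 3) (ZMod (p ^ t))) (H : Type*) [Group H],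
        Nonempty (H ≃* PresG p r t (T : Matrix (Fin 3) (Fin 3) (ZMod (p ^ t)))) →
          IsPEGroup p H) := by
  refine ⟨?_, fun r t _ htr h T H _ ⟨e⟩ => isPEGroup_of_mulEquiv_presG hp htr h T e⟩
  rintro G _ hG ⟨x, y, z, hxyz⟩ hna r t hr ht hpt
  obtain ⟨r', hr', hΩ⟩ := hG.omega_le_center
  obtain rfl : r = r' := Nat.pow_right_injective hp.two_le (hr.symm.trans hr')
  have hpow : ∀ x : G, x ^ p ^ r ∈ commutator G := fun x => by
    have := Monoid.pow_exponent_eq_one (x : G ⧸ commutator G)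
    rw [hr] at this
    exact (QuotientGroup.eq_one_iff (x ^ p ^ r)).1 this
  have hcen : ∀ x : G, x ^ p ^ r = 1 → x ∈ Subgroup.center G := fun x hx =>
    hΩ (Subgroup.subset_closure hx)
  let g : Fin 3 → G := ![x, y, z]
  have hg : Subgroup.closure (Set.range g) = ⊤ := by
    rw [← hxyz]
    simp only [g, Matrix.range_cons, Matrix.range_empty, Set.union_empty, Set.singleton_union]
  have hZ := commutator_le_center_of_engel hG.two_engel g hg hpow hcen
  -- Since `x ^ p ^ r` lies in `G'` and is central, `[x,y] ^ p ^ r = [x ^ p ^ r, y] = 1`; the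
  -- derived subgroup is abelian and generated by such commutators.
  have htr : t ≤ r := by
    rw [← Nat.pow_dvd_pow_iff_le_right hp.one_lt, ← ht, Monoid.exponent_dvd_iff_forall_pow_eq_one]
    rintro ⟨w, hw⟩
    obtain ⟨n, rfl⟩ := commutator_le_centralRange_commTriple hZ g hg hw
    have hc : ∀ x y : G, gcomm x y ^ p ^ r = 1 := fun x y => by
      rw [← gcomm_pow_left_of_commute
        (Subgroup.mem_center_iff.1 (hZ (gcomm_mem_commutator x y)) x).symm, gcomm_eq_one_iff]
      exact (Subgroup.mem_center_iff.1 (hZ (hpow x)) y).symm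
    have h1 := congrArg Additive.toMul (smul_centralHom_eq_zero (v := commTriple hZ g) (n := p ^ r)
      (fun i => Subtype.ext (by fin_cases i <;> exact hc _ _)) n)
    rw [natCast_zsmul, toMul_nsmul] at h1
    have h2 := congrArg Subtype.val h1
    exact Subtype.ext h2
  have ht1 : 1 ≤ t := by
    by_contra h0
    obtain rfl : t = 0 := by omega
    refine hna fun a b => (gcomm_eq_one_iff.1 ?_).eq
    have := Monoid.pow_exponent_eq_one (⟨_, gcomm_mem_commutator a b⟩ : commutator G)
    rw [ht, pow_zero, pow_one] at this
    exact congrArg Subtype.val this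
  have hpt' : 2 < p ∨ (p = 2 ∧ t ≠ r) := by
    refine hpt.imp_right fun ⟨h2, h⟩ => ⟨h2, fun htr' => h ?_⟩
    rw [ht, h2, htr']
  obtain ⟨T, ⟨e⟩⟩ := exists_presentation_of_class_two hp g hg hZ ht1 htr hpt' ht hpow hcen
  exact ⟨⟨ht1, htr⟩, by rw [← Nat.card_congr e.toEquiv, natCard_presG _ htr], T, ⟨e.symm⟩⟩
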